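/- **Setting.** Let $t=(t^{(1)},t^{(2)},t^{(3)})$ with $t^{(i)}=(t^{(i)}_1,t^{(i)}_2,\dots)$ be three infinite families of formal times and put $\xi(t^{(i)},z)=\sum_{k\ge1}t^{(i)}_kz^k$. For $\mathbf m=(m_1,m_2)\in\mathbb Z^2$ let $\mathbf e_1=(1,0)$, $\mathbf e_2=(0,1)$, $\mathbf e=(1,1)$, and let $t\mp[y]_i$ denote $t$ with $t^{(i)}_k$ replaced by $t^{(i)}_k\mp y^k/k$ for all $k\ge1$. Let $n_1,n_2,n_3\ge0$ be integers and let $\tau_{\mathbf m}(t)\in\mathbb C[[t]]$, $\mathbf m\in\mathbb Z^2$, be nonzero formal power series forming a tau function of the $[n_1,n_2,n_3]$-KdV hierarchy, i.e. for all $\mathbf m,\mathbf m'\in\mathbb Z^2$ and all integers $l\ge0$ $$\oint_{C_R}\frac{dz}{2\pi i}z^{n_1l+m_1-m_1'}e^{\xi(t^{(1)}-t'^{(1)},z)}\tau_{\mathbf m}(t-[z^{-1}]_1)\tau_{\mathbf m'}(t'+[z^{-1}]_1)$$ $$=\oint_{C_r}\frac{dz}{2\pi i}z^{-n_2l+m_2-m_2'}e^{\xi(t^{(2)}-t'^{(2)},z^{-1})}\tau_{\mathbf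 m+\mathbf e}(t-[z]_2)\tau_{\mathbf m'-\mathbf e}(t'+[z]_2)$$ $$+\oint_{C_r}\frac{dz}{2\pi i}(-1)^{m_2+m_2'}z^{-n_3l+m_1-m_2-m_1'+m_2'}e^{\xi(t^{(3)}-t'^{(3)},z^{-1})}\tau_{\mathbf m+\mathbf e_1}(t-[z]_3)\tau_{\mathbf m'-\mathbf e_1}(t'+[z]_3),$$ where the contour integrals (over a large circle $C_R$ and a small circle $C_r$) are understood formally, as the coefficient of $z^{-1}$ of the expanded integrand, an identity in $\mathbb C[[t,t']]$. Define the wave functions, series in $z^{\pm1}$ with coefficients in $\mathrm{Frac}\,\mathbb C[[t]]$, by $$\Psi_1=z^{m_1}e^{\xi(t^{(1)},z)}\frac{\tau_{\mathbf m}(t-[z^{-1}]_1)}{\tau_{\mathbf m}(t)},\quad \Psi_2=z^{m_2}e^{\xi(t^{(2)},z^{-1})}\frac{\tau_{\mathbf m+\mathbf e}(t-[z]_2)}{\tau_{\mathbf m}(t)},\quad \Psi_3=(-1)^{m_2}z^{m_1-m_2}e^{\xi(t^{(3)},z^{-1})}\frac{\tau_{\mathbf m+\mathbf e_1}(t-[z]_3)}{\tau_{\mathbf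 m}(t)}.$$ Let $\Lambda_i$ be the shift $\mathbf m\mapsto\mathbf m+\mathbf e_i$. Define the operators $$S_1(\Lambda_1)=\sum_{k\ge0}a^{(1)}_k\Lambda_1^{-k},\quad S_2(\Lambda_2)=\sum_{k\ge0}a^{(2)}_k\Lambda_2^{k},\quad S_3(\Lambda_1)=\sum_{k\ge0}a^{(3)}_k\Lambda_1^{k},\quad S_3(\Lambda_2^{-1})=\sum_{k\ge0}a^{(3)}_k\Lambda_2^{-k},$$ where $a^{(1)}_k$ is the coefficient of $z^{-k}$ in $\tau_{\mathbf m}(t-[z^{-1}]_1)/\tau_{\mathbf m}(t)$, and $a^{(2)}_k$, $a^{(3)}_k$ are the coefficients of $z^k$ in $\tau_{\mathbf m+\mathbf e}(t-[z]_2)/\tau_{\mathbf m}(t)$ and $(-1)^{m_2}\tau_{\mathbf m+\mathbf e_1}(t-[z]_3)/\tau_{\mathbf m}(t)$. These are invertible; put $$L_1(\Lambda_1)=S_1\Lambda_1S_1^{-1},\quad L_2(\Lambda_2)=S_2\Lambda_2^{-1}S_2^{-1},\quad L_3(\Lambda_1)=S_3(\Lambda_1)\Lambda_1^{-1}S_3(\Lambda_1)^{-1},\quad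 L_3(\Lambda_2^{-1})=S_3(\Lambda_2^{-1})\Lambda_2S_3(\Lambda_2^{-1})^{-1}.$$ For $k\ge0$ let $B^{(1)}_k(\Lambda_1)$ be the part of $L_1^k$ with nonnegative powers of $\Lambda_1$; $B^{(2)}_k(\Lambda_2)$ the part of $L_2^k$ with powers $\ge1$ of $\Delta_2^*=\Lambda_2^{-1}-1$, when $L_2^k$ is expanded in powers of $\Delta_2^*$; $B^{(3)}_k(\Lambda_1)$ the part of $L_3(\Lambda_1)^k$ with negative powers of $\Lambda_1$; $B^{(3)}_k(\Lambda_2^{-1})$ the part of $L_3(\Lambda_2^{-1})^k$ with powers $\ge1$ of $\Delta_2=\Lambda_2-1$, when $L_3(\Lambda_2^{-1})^k$ is expanded in powers of $\Delta_2$. (Expansions use $(\Delta+1)^i=\sum_{j\ge0}\binom ij\Delta^{i-j}$, $i\in\mathbb Z$.) All these parts are finite sums. **Theorem.** The difference operators $$\mathcal L=B^{(1)}_{n_1}(\Lambda_1)+B^{(2)}_{n_2}(\Lambda_2)+B^{(3)}_{n_3}(\Lambda_1),\qquad \widetilde{\mathcal L}=B^{(1)}_{n_1}(\Lambda_1)+B^{(2)}_{n_2}(\Lambda_2)+B^{(3)}_{n_3}(\Lambda_2^{-1})$$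 satisfy $$\mathcal L(\Psi_1)=z^{n_1}\Psi_1,\quad \mathcal L(\Psi_2)=z^{-n_2}\Psi_2,\quad \mathcal L(\Psi_3)=z^{-n_3}\Psi_3,$$ $$\widetilde{\mathcal L}(\Psi_1)=z^{n_1}\Psi_1,\quad \widetilde{\mathcal L}(\Psi_2)=z^{-n_2}\Psi_2,\quad \widetilde{\mathcal L}(\Psi_3)=z^{-n_3}\Psi_3.$$ -/

import Mathlib

/-!
Three-component KP: formal tau functions, wave functions, wave operators, Lax operators.
-/

noncomputable section

namespace ThreeKP

/-! ### Times, coefficient field, lattice -/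

/-- The index `(i, k)` stands for the time `t_k^{(i+1)}`, with `i + 1 ∈ {1, 2, 3}` and `k ≥ 1`. -/
abbrev Var : Type := Fin 3 × ℕ+

/-- Formal power series over `ℂ` in the variables indexed by `ι`. -/
abbrev Ser (ι : Type) : Type := MvPowerSeries ι ℂ

/-- The field of fractions of the ring of formal power series in all the times. -/
abbrev TField : Type := FractionRing (Ser Var)

/-- The lattice of the discrete variables `m = (m₁, m₂)`. -/
abbrev Lat : Type := ℤ × ℤ

/-- The functions of `m` and `t`, i.e. the coefficients of all operators. -/
abbrev Coef : Type := Lat → TField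

/-- The lattice acts on functions by shifts: `(v • f)(m) = f(m + v)`. -/
instance : MulSemiringAction (Multiplicative Lat) Coef where
  smul v f := fun m => f (m + v.toAdd)
  one_smul f := by
    funext m
    change f (m + 0) = f m
    rw [add_zero]
  mul_smul v w f := by
    funext m
    change f (m + (v.toAdd + w.toAdd)) = f (m + v.toAdd + w.toAdd)
    rw [add_assoc]
  smul_zero _ := rfl
  smul_add _ _ _ := rfl
  smul_one _ := rfl
  smul_mul _ _ _ := rfl

/-! ### Series in `z`

A series in `z`, infinite in both directions, is the function `n ↦ (coefficient of z ^ n)`. -/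

/-- The product `z ^ N * f`. -/
def zPow {A : Type} (N : ℤ) (f : ℤ → A) : ℤ → A := fun n => f (n - N)

/-- The product of two series in `z` whose coefficients are formal power series: the coefficient
of `z ^ n x ^ d` is the sum over `k` of the coefficients of `x ^ d` in `f k * g (n - k)`. In all
uses below this sum has finitely many nonzero terms. -/
def zMul {ι : Type} (f g : ℤ → Ser ι) : ℤ → Ser ι :=
  fun n d => ∑ᶠ k : ℤ, MvPowerSeries.coeff d (f k * g (n - k))

/-- The exponential `exp (∑ s, c s * z ^ (w s) * x s)
= ∑ d, (∏ s, (c s) ^ (d s) / (d s)!) * z ^ (∑ s, d s * w s) * x ^ d`. -/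
def zExp {ι : Type} (c : ι → ℂ) (w : ι → ℤ) : ℤ → Ser ι :=
  fun n d => if (d.sum fun s a => (a : ℤ) * w s) = n
    then d.prod fun s a => c s ^ a / (a.factorial : ℂ) else 0

/-- The local parameter belonging to the `i`-th family of times is `y_i = z ^ (locExp i)`, i.e.
`y = z⁻¹` for the first family, `y = z` for the second and for the third. -/
def locExp : Fin 3 → ℤ := ![-1, 1, 1]

/-- The coefficient of `y ^ j` in `f (t + ε [y]_i)`, by Taylor's formula; here `t + ε [y]_i` is `t`
with `t_k^{(i)}` replaced by `t_k^{(i)} + ε * y ^ k / k` for all `k ≥ 1`. -/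
def miwaCoeff (ε : ℂ) (i : Fin 3) (j : ℕ) (f : Ser Var) : Ser Var :=
  fun d => ∑ᶠ e : ℕ+ →₀ ℕ,
    if (e.sum fun k a => a * (k : ℕ)) = j then
      (e.prod fun k a => ((d (i, k) + a).choose a : ℂ) * (ε / (k : ℕ)) ^ a) *
        MvPowerSeries.coeff (d + e.mapDomain (Prod.mk i)) f
    else 0

/-- `f (t + ε [y_i]_i)` as a series in `z`. -/
def miwa (ε : ℂ) (i : Fin 3) (f : Ser Var) : ℤ → Ser Var :=
  fun n => if 0 ≤ locExp i * n then miwaCoeff ε i (locExp i * n).toNat f else 0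

/-- `exp (ξ (t^{(i)}, y_i⁻¹))`, where `ξ (t, z) = ∑ k, t_k z ^ k`. -/
def expXi (i : Fin 3) : ℤ → Ser Var :=
  zExp (fun s => if s.1 = i then 1 else 0) (fun s => -locExp i * (s.2 : ℕ))

/-- `exp (ξ (t^{(i)} - t'^{(i)}, y_i⁻¹))`, in the doubled set `(t, t')` of times. -/
def expXiDiff (i : Fin 3) : ℤ → Ser (Var ⊕ Var) :=
  zExp (Sum.elim (fun s => if s.1 = i then 1 else 0) (fun s => if s.1 = i then -1 else 0))
    (Sum.elim (fun s => -locExp i * (s.2 : ℕ)) (fun s => -locExp i * (s.2 : ℕ)))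

/-- The formal contour integral (residue, i.e. coefficient of `z ^ (-1)`) of
`z ^ N * exp (ξ (t^{(i)} - t'^{(i)}, y_i⁻¹)) * f (t - [y_i]_i) * g (t' + [y_i]_i)`. -/
def bilinearRes (i : Fin 3) (N : ℤ) (f g : Ser Var) : Ser (Var ⊕ Var) :=
  zPow N (zMul (expXiDiff i)
    (zMul (fun n => MvPowerSeries.rename Function.Embedding.inl (miwa (-1) i f n))
      (fun n => MvPowerSeries.rename Function.Embedding.inr (miwa 1 i g n)))) (-1)

/-- The family `τ` of tau functions satisfies the bilinear equations of the
`[n₁, n₂, n₃]`-KdV hierarchy. -/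
def IsKdVTau (n₁ n₂ n₃ : ℕ) (τ : Lat → Ser Var) : Prop :=
  ∀ (m m' : Lat) (l : ℕ),
    bilinearRes 0 (n₁ * l + m.1 - m'.1) (τ m) (τ m') =
      bilinearRes 1 (-(n₂ * l) + m.2 - m'.2) (τ (m + (1, 1))) (τ (m' - (1, 1))) +
      (-1 : ℂ) ^ (m.2 + m'.2) •
        bilinearRes 2 (-(n₃ * l) + m.1 - m.2 - m'.1 + m'.2)
          (τ (m + (1, 0))) (τ (m' - (1, 0)))

/-! ### Wave functions -/

/-- The series `z ^ N * exp (ξ (t^{(i)}, y_i⁻¹)) * f (t - [y_i]_i) / g (t)`. -/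
def waveSer (i : Fin 3) (N : ℤ) (f g : Ser Var) : ℤ → TField :=
  zPow N fun n => algebraMap (Ser Var) TField (zMul (expXi i) (miwa (-1) i f) n) /
    algebraMap (Ser Var) TField g

/-- `Ψ₁ = z ^ m₁ * exp (ξ (t^{(1)}, z)) * τ_m (t - [z⁻¹]_1) / τ_m (t)`. -/
def Psi1 (τ : Lat → Ser Var) : Lat → ℤ → TField :=
  fun m => waveSer 0 m.1 (τ m) (τ m)

/-- `Ψ₂ = z ^ m₂ * exp (ξ (t^{(2)}, z⁻¹)) * τ_{m + e₁ + e₂} (t - [z]_2) / τ_m (t)`. -/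
def Psi2 (τ : Lat → Ser Var) : Lat → ℤ → TField :=
  fun m => waveSer 1 m.2 (τ (m + (1, 1))) (τ m)

/-- `Ψ₃ = (-1) ^ m₂ * z ^ (m₁ - m₂) * exp (ξ (t^{(3)}, z⁻¹)) * τ_{m + e₁} (t - [z]_3) / τ_m (t)`. -/
def Psi3 (τ : Lat → Ser Var) : Lat → ℤ → TField :=
  fun m n => (-1) ^ m.2 * waveSer 2 (m.1 - m.2) (τ (m + (1, 0))) (τ m) n

/-! ### Difference operators -/

/-- The ring of difference operators `∑ a_{ij}(m) Λ₁ ^ i Λ₂ ^ j` (finite sums), with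
`Λ ^ v · a(m) = a(m + v) · Λ ^ v`. -/
abbrev DiffOp : Type := SkewMonoidAlgebra Coef (Multiplicative Lat)

/-- The operator `a(m) · Λ₁ ^ v₁ Λ₂ ^ v₂`. -/
def term (a : Coef) (v : Lat) : DiffOp := SkewMonoidAlgebra.single (Multiplicative.ofAdd v) a

/-- The action of a difference operator on functions of `m` with values in series in `z`. -/
def DiffOp.act (A : DiffOp) (Φ : Lat → ℤ → TField) : Lat → ℤ → TField :=
  fun m n => A.sum fun v a => a m * Φ (m + v.toAdd) n

/-! ### Pseudo-difference operators -/

/-- The formal operators `∑_{j ≥ N} a_j(m) x ^ j` where `x = Λ ^ v = Λ₁ ^ v₁ Λ₂ ^ v₂`. -/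
@[ext]
structure PDO (v : Lat) where
  /-- the coefficients -/
  coeff : ℤ → Coef
  bddBelow : ∃ N : ℤ, ∀ j < N, coeff j = 0

namespace PDO

variable {v : Lat}

/-- The shift `f(m) ↦ f(m + j v)`. -/
def sh (v : Lat) (j : ℤ) (f : Coef) : Coef := Multiplicative.ofAdd (j • v) • f

theorem sh_zero' (j : ℤ) : sh v j 0 = 0 := rfl

theorem sh_one' (j : ℤ) : sh v j 1 = 1 := rfl

theorem sh_add' (j : ℤ) (f g : Coef) : sh v j (f + g) = sh v j f + sh v j g := rfl

theorem sh_mul' (j : ℤ) (f g : Coef) : sh v j (f * g) = sh v j f * sh v j g := rfl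

theorem zero_sh (f : Coef) : sh v 0 f = f := by simp [sh]

theorem add_sh (i j : ℤ) (f : Coef) : sh v (i + j) f = sh v i (sh v j f) := by
  simp [sh, add_smul, mul_smul]

theorem sh_sum {ι : Type*} (s : Finset ι) (j : ℤ) (f : ι → Coef) :
    sh v j (∑ i ∈ s, f i) = ∑ i ∈ s, sh v j (f i) := by
  simp [sh, Finset.smul_sum]

/-- The coefficient of `x ^ n` in the product of `∑ a_i x ^ i` and `∑ b_j x ^ j` is
`∑ a_i(m) b_{n-i}(m + i v)`. -/
def mulCoeff (v : Lat) (a b : ℤ → Coef) (n : ℤ) : Coef :=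
  ∑ᶠ i : ℤ, a i * sh v i (b (n - i))

theorem mulCoeff_eq {a b : ℤ → Coef} {M N : ℤ} (ha : ∀ j < M, a j = 0) (hb : ∀ j < N, b j = 0)
    (n : ℤ) (s : Finset ℤ) (hs : Finset.Icc M (n - N) ⊆ s) :
    mulCoeff v a b n = ∑ i ∈ s, a i * sh v i (b (n - i)) := by
  refine finsum_eq_sum_of_support_subset _ fun i hi => ?_
  apply hs
  rw [Finset.mem_Icc]
  by_contra h
  apply hi
  by_cases h1 : i < M
  · simp [ha i h1]
  · simp only [hb (n - i) (by lia), sh_zero', mul_zero]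

theorem mulCoeff_lt {a b : ℤ → Coef} {M N : ℤ} (ha : ∀ j < M, a j = 0) (hb : ∀ j < N, b j = 0)
    (n : ℤ) (hn : n < M + N) : mulCoeff v a b n = 0 := by
  rw [mulCoeff_eq ha hb n (Finset.Icc M (n - N)) subset_rfl, Finset.Icc_eq_empty (by lia),
    Finset.sum_empty]

instance : Zero (PDO v) := ⟨⟨0, 0, fun _ _ => rfl⟩⟩

instance : Add (PDO v) := ⟨fun A B => ⟨A.coeff + B.coeff, by
  obtain ⟨M, hM⟩ := A.bddBelow
  obtain ⟨N, hN⟩ := B.bddBelow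
  exact ⟨min M N, fun j hj => by
    simp [hM j (lt_of_lt_of_le hj (min_le_left _ _)),
      hN j (lt_of_lt_of_le hj (min_le_right _ _))]⟩⟩⟩

instance : Neg (PDO v) := ⟨fun A => ⟨-A.coeff, by
  obtain ⟨M, hM⟩ := A.bddBelow
  exact ⟨M, fun j hj => by simp [hM j hj]⟩⟩⟩

instance : Mul (PDO v) := ⟨fun A B => ⟨mulCoeff v A.coeff B.coeff, by
  obtain ⟨M, hM⟩ := A.bddBelow
  obtain ⟨N, hN⟩ := B.bddBelow
  exact ⟨M + N, mulCoeff_lt hM hN⟩⟩⟩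

/-- The operator `a(m) x ^ j`. -/
def mono (v : Lat) (j : ℤ) (a : Coef) : PDO v :=
  ⟨fun i => if i = j then a else 0, j, fun _ hi => if_neg hi.ne⟩

instance : One (PDO v) := ⟨mono v 0 1⟩

theorem zero_coeff : (0 : PDO v).coeff = 0 := rfl

theorem add_coeff (A B : PDO v) : (A + B).coeff = A.coeff + B.coeff := rfl

theorem neg_coeff (A : PDO v) : (-A).coeff = -A.coeff := rfl

theorem mul_coeff (A B : PDO v) : (A * B).coeff = mulCoeff v A.coeff B.coeff := rfl

theorem one_coeff (i : ℤ) : (1 : PDO v).coeff i = if i = 0 then 1 else 0 := rfl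

theorem mul_assoc' (A B C : PDO v) : A * B * C = A * (B * C) := by
  obtain ⟨a, ha⟩ := A.bddBelow
  obtain ⟨b, hb⟩ := B.bddBelow
  obtain ⟨c, hc⟩ := C.bddBelow
  apply PDO.ext
  funext n
  have hL := mulCoeff_lt (v := v) ha hb
  have hR := mulCoeff_lt (v := v) hb hc
  simp only [mul_coeff]
  rw [mulCoeff_eq hL hc n (Finset.Icc (a + b) (n - c)) subset_rfl,
    mulCoeff_eq ha hR n (Finset.Icc a (n - (b + c))) subset_rfl]
  have h1 : ∀ j ∈ Finset.Icc (a + b) (n - c),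
      mulCoeff v A.coeff B.coeff j * sh v j (C.coeff (n - j)) =
        ∑ i ∈ Finset.Icc a (n - (b + c)),
          A.coeff i * sh v i (B.coeff (j - i)) * sh v j (C.coeff (n - j)) := by
    intro j hj
    rw [Finset.mem_Icc] at hj
    rw [mulCoeff_eq ha hb j (Finset.Icc a (n - (b + c)))
      (Finset.Icc_subset_Icc_right (by lia)), Finset.sum_mul]
  rw [Finset.sum_congr rfl h1, Finset.sum_comm]
  refine Finset.sum_congr rfl fun i hi => ?_
  rw [Finset.mem_Icc] at hi
  rw [mulCoeff_eq hb hc (n - i) (Finset.Icc (a + b - i) (n - c - i))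
    (Finset.Icc_subset_Icc (by lia) (by lia)), sh_sum, Finset.mul_sum]
  refine Finset.sum_nbij' (fun j => j - i) (fun k => k + i) ?_ ?_ ?_ ?_ ?_
  · intro j hj
    rw [Finset.mem_Icc] at hj ⊢
    lia
  · intro j hj
    rw [Finset.mem_Icc] at hj ⊢
    lia
  · intro j _
    lia
  · intro j _
    lia
  · intro j _
    rw [sh_mul', ← add_sh, mul_assoc, show i + (j - i) = j by lia,
      show n - i - (j - i) = n - j by lia]

theorem left_distrib' (A B C : PDO v) : A * (B + C) = A * B + A * C := by
  obtain ⟨a, ha⟩ := A.bddBelow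
  obtain ⟨b, hb⟩ := B.bddBelow
  obtain ⟨c, hc⟩ := C.bddBelow
  obtain ⟨d, hd⟩ := (B + C).bddBelow
  apply PDO.ext
  funext n
  rw [add_coeff, Pi.add_apply, mul_coeff, mul_coeff, mul_coeff]
  have key : ∀ e ∈ ({b, c, d} : Finset ℤ), min b (min c d) ≤ e := by
    intro e he
    simp only [Finset.mem_insert, Finset.mem_singleton] at he
    lia
  rw [mulCoeff_eq ha hd n (Finset.Icc a (n - min b (min c d)))
      (Finset.Icc_subset_Icc_right (by have := key d (by simp); lia)),
    mulCoeff_eq ha hb n (Finset.Icc a (n - min b (min c d)))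
      (Finset.Icc_subset_Icc_right (by have := key b (by simp); lia)),
    mulCoeff_eq ha hc n (Finset.Icc a (n - min b (min c d)))
      (Finset.Icc_subset_Icc_right (by have := key c (by simp); lia)), ← Finset.sum_add_distrib]
  refine Finset.sum_congr rfl fun i _ => ?_
  rw [add_coeff, Pi.add_apply, sh_add', mul_add]

theorem right_distrib' (A B C : PDO v) : (A + B) * C = A * C + B * C := by
  obtain ⟨a, ha⟩ := A.bddBelow
  obtain ⟨b, hb⟩ := B.bddBelow
  obtain ⟨c, hc⟩ := C.bddBelow
  obtain ⟨d, hd⟩ := (A + B).bddBelow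
  apply PDO.ext
  funext n
  rw [add_coeff, Pi.add_apply, mul_coeff, mul_coeff, mul_coeff]
  have key : ∀ e ∈ ({a, b, d} : Finset ℤ), min a (min b d) ≤ e := by
    intro e he
    simp only [Finset.mem_insert, Finset.mem_singleton] at he
    lia
  rw [mulCoeff_eq hd hc n (Finset.Icc (min a (min b d)) (n - c))
      (Finset.Icc_subset_Icc_left (key d (by simp))),
    mulCoeff_eq ha hc n (Finset.Icc (min a (min b d)) (n - c))
      (Finset.Icc_subset_Icc_left (key a (by simp))),
    mulCoeff_eq hb hc n (Finset.Icc (min a (min b d)) (n - c))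
      (Finset.Icc_subset_Icc_left (key b (by simp))), ← Finset.sum_add_distrib]
  refine Finset.sum_congr rfl fun i _ => ?_
  rw [add_coeff, Pi.add_apply, add_mul]

theorem one_mul' (A : PDO v) : 1 * A = A := by
  apply PDO.ext
  funext n
  rw [mul_coeff, mulCoeff, finsum_eq_single _ 0 fun i hi => by
    rw [one_coeff, if_neg hi, zero_mul]]
  rw [one_coeff, if_pos rfl, one_mul, zero_sh, sub_zero]

theorem mul_one' (A : PDO v) : A * 1 = A := by
  apply PDO.ext
  funext n
  rw [mul_coeff, mulCoeff, finsum_eq_single _ n fun i hi => by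
    rw [one_coeff, if_neg (by lia), sh_zero', mul_zero]]
  rw [one_coeff, sub_self, if_pos rfl, sh_one', mul_one]

theorem zero_mul' (A : PDO v) : 0 * A = 0 := by
  apply PDO.ext
  funext n
  simp [mul_coeff, mulCoeff, zero_coeff]

theorem mul_zero' (A : PDO v) : A * 0 = 0 := by
  apply PDO.ext
  funext n
  simp [mul_coeff, mulCoeff, zero_coeff, sh_zero']

instance : Ring (PDO v) where
  add_assoc _ _ _ := PDO.ext (add_assoc _ _ _)
  zero_add _ := PDO.ext (zero_add _)
  add_zero _ := PDO.ext (add_zero _)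
  add_comm _ _ := PDO.ext (add_comm _ _)
  neg_add_cancel _ := PDO.ext (neg_add_cancel _)
  mul_assoc := mul_assoc'
  one_mul := one_mul'
  mul_one := mul_one'
  left_distrib := left_distrib'
  right_distrib := right_distrib'
  zero_mul := zero_mul'
  mul_zero := mul_zero'
  nsmul := nsmulRec
  zsmul := zsmulRec

/-- The operator `∑_{k ≥ 0} s_k(m) x ^ k`. -/
def ofSeq (v : Lat) (s : ℕ → Coef) : PDO v :=
  ⟨fun j => if 0 ≤ j then s j.toNat else 0, 0, fun j hj => if_neg (by lia)⟩

/-- The coefficients of the left inverse of `∑_{k ≥ 0} s_k x ^ k`. -/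
def invSeq (v : Lat) (s : ℕ → Coef) (n : ℕ) : Coef :=
  ((if n = 0 then 1 else 0) - ∑ i : Fin n, invSeq v s i * sh v (i : ℕ) (s (n - i))) *
    (sh v n (s 0))⁻¹
termination_by n
decreasing_by exact i.2

theorem sh_mul_inv (n : ℤ) (f : Coef) (h : ∀ m, f m ≠ 0) : (sh v n f)⁻¹ * sh v n f = 1 := by
  funext m
  exact inv_mul_cancel₀ (h _)

theorem ofSeq_coeff (s : ℕ → Coef) (j : ℤ) :
    (ofSeq v s).coeff j = if 0 ≤ j then s j.toNat else 0 := rfl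

theorem invSeq_mul (s : ℕ → Coef) (h : ∀ m, s 0 m ≠ 0) :
    ofSeq v (invSeq v s) * ofSeq v s = 1 := by
  have h0 : ∀ t : ℕ → Coef, ∀ j < 0, (ofSeq v t).coeff j = 0 := fun t j hj => if_neg (by lia)
  apply PDO.ext
  funext n
  rw [mul_coeff, one_coeff]
  by_cases hn : n < 0
  · rw [mulCoeff_lt (h0 _) (h0 _) n (by lia), if_neg (by lia)]
  lift n to ℕ using not_lt.mp hn
  rw [mulCoeff_eq (h0 _) (h0 _) n ((Finset.range (n + 1)).map Nat.castEmbedding) (by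
    intro i hi
    rw [Finset.mem_Icc] at hi
    rw [Finset.mem_map]
    exact ⟨i.toNat, Finset.mem_range.mpr (by lia), by simp [hi.1]⟩)]
  rw [Finset.sum_map, Finset.sum_range_succ]
  have h1 : ∀ i ∈ Finset.range n, (ofSeq v (invSeq v s)).coeff (Nat.castEmbedding i) *
      sh v (Nat.castEmbedding i) ((ofSeq v s).coeff (n - Nat.castEmbedding i)) =
      invSeq v s i * sh v i (s (n - i)) := by
    intro i hi
    rw [Finset.mem_range] at hi
    rw [Nat.castEmbedding_apply, ofSeq_coeff, ofSeq_coeff, if_pos (by lia), if_pos (by lia),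
      Int.toNat_natCast, show ((n : ℤ) - i).toNat = n - i by lia]
  rw [Finset.sum_congr rfl h1, Nat.castEmbedding_apply, ofSeq_coeff, ofSeq_coeff,
    if_pos (by lia), if_pos (by lia), Int.toNat_natCast, sub_self, Int.toNat_zero,
    invSeq, mul_assoc, sh_mul_inv _ _ h, mul_one, Finset.sum_range]
  simp

theorem invSeq_zero_ne (s : ℕ → Coef) (h : ∀ m, s 0 m ≠ 0) (m : Lat) : invSeq v s 0 m ≠ 0 := by
  have h1 : invSeq v s 0 = (sh v 0 (s 0))⁻¹ := by
    rw [invSeq]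
    simp
  rw [h1]
  exact inv_ne_zero (h _)

/-- A series with nowhere vanishing leading coefficient is invertible. -/
theorem isUnit_ofSeq (s : ℕ → Coef) (h : ∀ m, s 0 m ≠ 0) : IsUnit (ofSeq v s) := by
  have h1 := invSeq_mul (v := v) s h
  have h2 := invSeq_mul (v := v) (invSeq v s) (invSeq_zero_ne s h)
  have h3 := left_inv_eq_right_inv h2 h1
  rw [h3] at h2
  exact ⟨⟨_, _, h2, h1⟩, rfl⟩

/-- The part of `A = ∑ a_j x ^ j` with `j ≤ n`, a difference operator. -/
def partLE (A : PDO v) (n : ℤ) : DiffOp :=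
  ∑ᶠ j : ℤ, if j ≤ n then term (A.coeff j) (j • v) else 0

/-- The coefficient of `Δ ^ p` in the expansion of `A = ∑ a_j x ^ j` in powers of `Δ = x⁻¹ - 1`,
obtained from `x ^ (-i) = (Δ + 1) ^ i = ∑_{j ≥ 0} (i choose j) Δ ^ (i - j)` for `i ∈ ℤ`. -/
def deltaCoeff (A : PDO v) (p : ℤ) : Coef :=
  ∑ᶠ j : ℕ, (Ring.choose (p + j) j : ℤ) • A.coeff (-(p + j))

/-- The part of `A` with powers `≥ 1` with respect to `Δ = x⁻¹ - 1`, a difference operator. -/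
def deltaPartPos (A : PDO v) : DiffOp :=
  ∑ᶠ p : ℕ, if 1 ≤ p then term (A.deltaCoeff p) 0 * (term 1 (-v) - 1) ^ p else 0

end PDO

/-! ### Wave operators and Lax operators -/

/-- The coefficient of `y_i ^ k` in `f_m (t - [y_i]_i) / τ_m (t)`. -/
def waveCoeff (i : Fin 3) (f τ : Lat → Ser Var) (k : ℕ) : Coef := fun m =>
  algebraMap (Ser Var) TField (miwaCoeff (-1) i k (f m)) / algebraMap (Ser Var) TField (τ m)

/-- `S₁ (Λ₁)`, a series in `x = Λ₁⁻¹`, with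
`S₁ exp (ξ (t^{(1)}, Λ₁)) (z ^ m₁) = Ψ₁`. -/
def S1 (τ : Lat → Ser Var) : PDO (-1, 0) :=
  PDO.ofSeq _ (waveCoeff 0 τ τ)

/-- `S₂ (Λ₂)`, a series in `x = Λ₂`, with
`S₂ exp (ξ (t^{(2)}, Λ₂⁻¹)) (z ^ m₂) = Ψ₂`. -/
def S2 (τ : Lat → Ser Var) : PDO (0, 1) :=
  PDO.ofSeq _ (waveCoeff 1 (fun m => τ (m + (1, 1))) τ)

/-- The coefficients of the wave operator `S₃`. -/
def s3 (τ : Lat → Ser Var) (k : ℕ) : Coef := fun m =>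
  (-1) ^ m.2 * waveCoeff 2 (fun m => τ (m + (1, 0))) τ k m

/-- `S₃ (Λ₁)`, a series in `x = Λ₁`, with
`S₃ exp (ξ (t^{(3)}, Λ₁⁻¹)) (z ^ (m₁ - m₂)) = Ψ₃`. -/
def S3 (τ : Lat → Ser Var) : PDO (1, 0) := PDO.ofSeq _ (s3 τ)

/-- `S₃ (Λ₂⁻¹)`: the same coefficients as `S₃ (Λ₁)`, with `x = Λ₂⁻¹`. -/
def S3' (τ : Lat → Ser Var) : PDO (0, -1) := PDO.ofSeq _ (s3 τ)

theorem miwaCoeff_zero (ε : ℂ) (i : Fin 3) (f : Ser Var) : miwaCoeff ε i 0 f = f := by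
  funext d
  rw [miwaCoeff, finsum_eq_single _ 0 fun e he => if_neg fun h => he ?_]
  · simp
    rfl
  · ext k
    by_contra hk
    have h1 := (Finset.sum_eq_zero_iff.mp h) k (Finsupp.mem_support_iff.mpr hk)
    simp only [mul_eq_zero, PNat.ne_zero, or_false] at h1
    exact hk h1

theorem waveCoeff_zero_ne (i : Fin 3) (f τ : Lat → Ser Var) (hf : ∀ m, f m ≠ 0)
    (hτ : ∀ m, τ m ≠ 0) (m : Lat) : waveCoeff i f τ 0 m ≠ 0 := by
  have hinj := IsFractionRing.injective (Ser Var) TField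
  rw [waveCoeff, miwaCoeff_zero]
  exact div_ne_zero ((map_ne_zero_iff _ hinj).mpr (hf m)) ((map_ne_zero_iff _ hinj).mpr (hτ m))

/-- The wave operators are invertible, so that `Ring.inverse` below is the actual inverse. -/
theorem isUnit_wave (τ : Lat → Ser Var) (hτ : ∀ m, τ m ≠ 0) :
    IsUnit (S1 τ) ∧ IsUnit (S2 τ) ∧ IsUnit (S3 τ) ∧ IsUnit (S3' τ) := by
  have h3 : ∀ m, s3 τ 0 m ≠ 0 := fun m =>
    mul_ne_zero (zpow_ne_zero _ (neg_ne_zero.mpr one_ne_zero))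
      (waveCoeff_zero_ne 2 _ τ (fun _ => hτ _) hτ m)
  exact ⟨PDO.isUnit_ofSeq _ (waveCoeff_zero_ne 0 τ τ hτ hτ),
    PDO.isUnit_ofSeq _ (waveCoeff_zero_ne 1 _ τ (fun _ => hτ _) hτ),
    PDO.isUnit_ofSeq _ h3, PDO.isUnit_ofSeq _ h3⟩

/-- The dressed operator `S x⁻¹ S⁻¹`. -/
def dress {v : Lat} (S : PDO v) : PDO v := S * PDO.mono v (-1) 1 * Ring.inverse S

/-- `L₁ (Λ₁) = S₁ Λ₁ S₁⁻¹`. -/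
def L1 (τ : Lat → Ser Var) : PDO (-1, 0) := dress (S1 τ)

/-- `L₂ (Λ₂) = S₂ Λ₂⁻¹ S₂⁻¹`. -/
def L2 (τ : Lat → Ser Var) : PDO (0, 1) := dress (S2 τ)

/-- `L₃ (Λ₁) = S₃ (Λ₁) Λ₁⁻¹ S₃ (Λ₁)⁻¹`. -/
def L3 (τ : Lat → Ser Var) : PDO (1, 0) := dress (S3 τ)

/-- `L₃ (Λ₂⁻¹) = S₃ (Λ₂⁻¹) Λ₂ S₃ (Λ₂⁻¹)⁻¹`. -/
def L3' (τ : Lat → Ser Var) : PDO (0, -1) := dress (S3' τ)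

/-- `B_k^{(1)} (Λ₁)`, the part of `L₁ ^ k` with nonnegative powers of `Λ₁ = x⁻¹`. -/
def B1 (τ : Lat → Ser Var) (k : ℕ) : DiffOp := (L1 τ ^ k).partLE 0

/-- `B_k^{(2)} (Λ₂)`, the part of `L₂ ^ k` with powers `≥ 1` of `Δ₂^* = Λ₂⁻¹ - 1`. -/
def B2 (τ : Lat → Ser Var) (k : ℕ) : DiffOp := (L2 τ ^ k).deltaPartPos

/-- `B_k^{(3)} (Λ₁)`, the part of `L₃ (Λ₁) ^ k` with negative powers of `Λ₁ = x`. -/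
def B3 (τ : Lat → Ser Var) (k : ℕ) : DiffOp := (L3 τ ^ k).partLE (-1)

/-- `B_k^{(3)} (Λ₂⁻¹)`, the part of `L₃ (Λ₂⁻¹) ^ k` with powers `≥ 1` of `Δ₂ = Λ₂ - 1`. -/
def B3' (τ : Lat → Ser Var) (k : ℕ) : DiffOp := (L3' τ ^ k).deltaPartPos

/-- `𝓛 = B_{n₁}^{(1)} (Λ₁) + B_{n₂}^{(2)} (Λ₂) + B_{n₃}^{(3)} (Λ₁)`. -/
def laxOp (n₁ n₂ n₃ : ℕ) (τ : Lat → Ser Var) : DiffOp := B1 τ n₁ + B2 τ n₂ + B3 τ n₃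

/-- `𝓛̃ = B_{n₁}^{(1)} (Λ₁) + B_{n₂}^{(2)} (Λ₂) + B_{n₃}^{(3)} (Λ₂⁻¹)`. -/
def laxOp' (n₁ n₂ n₃ : ℕ) (τ : Lat → Ser Var) : DiffOp := B1 τ n₁ + B2 τ n₂ + B3' τ n₃

end ThreeKP

end

/-!
The residues of the three wave functions against the adjoint wave functions add up to zero. On the
diagonal `t' = t` of the bilinear identity the exponential factors cancel, so this holds for the
bare wave functions, which are Laurent series in the local parameters `y_i`. It also holds for every
difference operator applied to them and, by the case `l = 1`, for their multiples by the powers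
`y_i ^ (-n_i)`. The pairing is triangular in the degrees of the adjoint wave functions, so a triple
of series of sufficiently high order which pairs to zero with all of them is zero.

The operator `B^{(i)}` is cut off from `L_i ^ (n_i)`, which multiplies the `i`-th wave function by
`y_i ^ (-n_i)`, exactly so that it agrees with this multiplication on the `i`-th wave function and
kills the two other ones up to terms of that order. Hence the relations hold without the exponential
factors. Multiplication by the exponential factors is linear over the power series in the times, and
it therefore preserves relations with coefficients in the field of fractions.
-/

noncomputable section

namespace ThreeKP

/-! ### Series in `z` -/

section Series

variable {ι κ : Type}

theorem coeff_zMul (f g : ℤ → Ser ι) (n : ℤ) (d : ι →₀ ℕ) :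
    MvPowerSeries.coeff d (zMul f g n) = ∑ᶠ k : ℤ, MvPowerSeries.coeff d (f k * g (n - k)) :=
  rfl

theorem zMul_zPow (f g : ℤ → Ser ι) (N : ℤ) : zMul f (zPow N g) = zPow N (zMul f g) := by
  funext n d
  simp only [zMul, zPow, sub_right_comm]

theorem single_zero_one_zMul (g : ℤ → Ser ι) : zMul (Pi.single 0 1) g = g := by
  funext n
  ext d
  rw [coeff_zMul,
    finsum_eq_single _ 0 fun k hk => by rw [Pi.single_eq_of_ne hk, zero_mul, map_zero],
    Pi.single_eq_same, one_mul, sub_zero]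

/-- Each monomial `x ^ d` occurs in only finitely many coefficients of the series `f` in `z`. This
makes all sums in `zMul f g` finite, whatever the series `g`. -/
def IsLocallyFinite (f : ℤ → Ser ι) : Prop :=
  ∀ d, ∀ᶠ k in Filter.cofinite, MvPowerSeries.coeff d (f k) = 0

theorem isLocallyFinite_zExp (c : ι → ℂ) (w : ι → ℤ) : IsLocallyFinite (zExp c w) := fun d =>
  (Set.finite_singleton (d.sum fun s a => (a : ℤ) * w s)).subset fun _ hk =>
    by_contra fun hne => hk (if_neg fun h => hne h.symm)

namespace IsLocallyFinite

variable {f : ℤ → Ser ι}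

theorem eventually_coeff_zMul (hf : IsLocallyFinite f) (d : ι →₀ ℕ) :
    ∀ᶠ K : Finset ℤ in Filter.atTop, ∀ g n, MvPowerSeries.coeff d (zMul f g n) =
      MvPowerSeries.coeff d (∑ k ∈ K, f k * g (n - k)) := by
  classical
  have hfin : ∀ᶠ k in Filter.cofinite,
      ∀ p ∈ Finset.HasAntidiagonal.antidiagonal d, MvPowerSeries.coeff p.1 (f k) = 0 :=
    (Filter.eventually_all_finset _).mpr fun p _ => hf p.1
  filter_upwards [Filter.eventually_ge_atTop (Filter.eventually_cofinite.mp hfin).toFinset]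
    with K hK g n
  rw [map_sum, coeff_zMul]
  refine finsum_eq_sum_of_support_subset _ fun k hk => hK ?_
  rw [Set.Finite.mem_toFinset]
  intro hzero
  refine hk ((MvPowerSeries.coeff_mul d (f k) (g (n - k))).trans ?_)
  exact Finset.sum_eq_zero fun p hp => by rw [hzero p hp, zero_mul]

/-- Multiplication by a locally finite series in `z`, as a linear map. -/
def zMulLinear (hf : IsLocallyFinite f) : (ℤ → Ser ι) →ₗ[Ser ι] ℤ → Ser ι where
  toFun := zMul f
  map_add' g h := by
    funext n
    ext d
    obtain ⟨K, hK⟩ := (hf.eventually_coeff_zMul d).exists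
    simp only [Pi.add_apply, map_add, hK, mul_add, Finset.sum_add_distrib]
  map_smul' a g := by
    classical
    funext n
    ext d
    obtain ⟨K, hd, hK⟩ := ((hf.eventually_coeff_zMul d).and
      ((Filter.eventually_all_finset (Finset.HasAntidiagonal.antidiagonal d)).mpr
        fun p _ => hf.eventually_coeff_zMul p.2)).exists
    have hmul : MvPowerSeries.coeff d (a * zMul f g n) =
        MvPowerSeries.coeff d (a * ∑ k ∈ K, f k * g (n - k)) := by
      rw [MvPowerSeries.coeff_mul, MvPowerSeries.coeff_mul]
      exact Finset.sum_congr rfl fun p hp => by rw [hK p hp]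
    rw [RingHom.id_apply, Pi.smul_apply, smul_eq_mul, hmul, hd]
    simp only [Pi.smul_apply, smul_eq_mul, mul_left_comm, Finset.mul_sum]

theorem rename (hf : IsLocallyFinite f) (φ : ι → κ) [Filter.TendstoCofinite φ] :
    IsLocallyFinite fun k => MvPowerSeries.rename φ (f k) := fun d => by
  simp only [MvPowerSeries.coeff_rename]
  filter_upwards [(Filter.eventually_all_finset _).mpr fun x _ => hf x] with k hk
  exact Finset.sum_eq_zero hk

theorem rename_zMul (hf : IsLocallyFinite f) (φ : ι → κ) [Filter.TendstoCofinite φ]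
    (g : ℤ → Ser ι) (n : ℤ) :
    MvPowerSeries.rename φ (zMul f g n) =
      zMul (fun k => MvPowerSeries.rename φ (f k)) (fun k => MvPowerSeries.rename φ (g k)) n := by
  ext d
  obtain ⟨K, hd, hK⟩ := (((hf.rename φ).eventually_coeff_zMul d).and
    ((Filter.eventually_all_finset _).mpr fun x _ => hf.eventually_coeff_zMul x)).exists
  rw [hd, MvPowerSeries.coeff_rename, Finset.sum_congr rfl fun x hx => hK x hx g n,
    ← MvPowerSeries.coeff_rename]
  simp only [map_sum, map_mul]

end IsLocallyFinite

end Series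

section ClearDenominators

variable {R K X Y κ : Type*} [CommRing R] [CommRing K] [Algebra R K] [IsFractionRing R K]

/-- One can clear the denominators of the coefficients `b`. -/
theorem sum_mul_algebraMap_map_eq_zero (T : (X → R) →ₗ[R] Y → R) (s : Finset κ) (b : κ → K)
    (F : κ → X → R) (h : ∀ x, ∑ v ∈ s, b v * algebraMap R K (F v x) = 0) (y : Y) :
    ∑ v ∈ s, b v * algebraMap R K (T (F v) y) = 0 := by
  obtain ⟨q, hq⟩ := IsLocalization.exist_integer_multiples (nonZeroDivisors R) s b
  choose! a ha using hq
  have clear_denominators (c : κ → R) : algebraMap R K (∑ v ∈ s, a v * c v) =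
      algebraMap R K q * ∑ v ∈ s, b v * algebraMap R K (c v) := by
    rw [map_sum, Finset.mul_sum]
    refine Finset.sum_congr rfl fun v hv => ?_
    rw [map_mul, ha v hv, Algebra.smul_def, mul_assoc]
  have relation : ∑ v ∈ s, a v • F v = 0 := by
    funext x
    apply IsFractionRing.injective R K
    simp only [Finset.sum_apply, Pi.smul_apply, smul_eq_mul, Pi.zero_apply]
    rw [clear_denominators, h, mul_zero, map_zero]
  have image_relation : ∑ v ∈ s, a v * T (F v) y = 0 := by
    simpa only [map_sum, map_smul, map_zero, Finset.sum_apply, Pi.smul_apply, smul_eq_mul,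
      Pi.zero_apply] using congrFun (congrArg T relation) y
  rw [← (IsLocalization.map_units K q).mul_right_eq_zero, ← clear_denominators, image_relation,
    map_zero]

theorem sum_mul_algebraMap_map_eq (T : (X → R) →ₗ[R] Y → R) (s : Finset κ) (b : κ → K)
    (F : κ → X → R) (c : K) (G : X → R)
    (h : ∀ x, ∑ v ∈ s, b v * algebraMap R K (F v x) = c * algebraMap R K (G x)) (y : Y) :
    ∑ v ∈ s, b v * algebraMap R K (T (F v) y) = c * algebraMap R K (T G y) := by
  have key := sum_mul_algebraMap_map_eq_zero T (Finset.insertNone s)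
    (fun o => o.elim (-c) b) (fun o => o.elim G F) (fun x => by
      simp only [Finset.sum_insertNone, Option.elim_none, Option.elim_some, h, neg_mul,
        neg_add_cancel]) y
  rw [Finset.sum_insertNone] at key
  simp only [Option.elim_none, Option.elim_some, neg_mul] at key
  exact (neg_add_eq_zero.mp key).symm

end ClearDenominators

/-! ### The diagonal `t' = t` -/

section Diagonal

variable {ι : Type}

instance tendstoCofinite_fold : Filter.TendstoCofinite (Sum.elim id id : ι ⊕ ι → ι) := by
  rw [Filter.tendstoCofinite_iff_finite_preimage_singleton]
  intro s
  refine (Set.toFinite ({Sum.inl s, Sum.inr s} : Set (ι ⊕ ι))).subset ?_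
  rintro (x | x) h
  · exact Or.inl (congrArg Sum.inl h)
  · exact Or.inr (congrArg Sum.inr h)

/-- The restriction to the diagonal `t' = t` of a power series in the doubled set `(t, t')` of
variables. -/
def diag : Ser (ι ⊕ ι) →ₐ[ℂ] Ser ι := MvPowerSeries.rename (Sum.elim id id)

theorem diag_rename_inl (f : Ser ι) :
    diag (MvPowerSeries.rename Function.Embedding.inl f) = f := by
  rw [diag, MvPowerSeries.rename_rename]
  exact MvPowerSeries.rename_id_apply f

theorem diag_rename_inr (f : Ser ι) :
    diag (MvPowerSeries.rename Function.Embedding.inr f) = f := by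
  rw [diag, MvPowerSeries.rename_rename]
  exact MvPowerSeries.rename_id_apply f

theorem mapDomain_fold_apply (x : ι ⊕ ι →₀ ℕ) (s : ι) :
    x.mapDomain (Sum.elim id id : ι ⊕ ι → ι) s = x (Sum.inl s) + x (Sum.inr s) := by
  classical
  induction x using Finsupp.induction_linear with
  | zero => rfl
  | add f g hf hg =>
    rw [Finsupp.mapDomain_add, Finsupp.add_apply, hf, hg, Finsupp.add_apply, Finsupp.add_apply,
      add_add_add_comm]
  | single a b =>
    rw [Finsupp.mapDomain_single]
    rcases a with a | a <;> simp [Finsupp.single_apply]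

theorem coeff_zExp (c : ι → ℂ) (w : ι → ℤ) (k : ℤ) (d : ι →₀ ℕ) :
    MvPowerSeries.coeff d (zExp c w k) = if (d.sum fun s a => (a : ℤ) * w s) = k
      then d.prod fun s a => c s ^ a / (a.factorial : ℂ) else 0 := rfl

/-- Coefficientwise form of `∂E/∂x_s = c_s z ^ (w s) E` for `E = exp (∑ s, c s * z ^ (w s) * x s)`,
multiplied by `x_s`. -/
theorem coeff_C_mul_X_mul_zExp (c : ι → ℂ) (w : ι → ℤ) (k : ℤ) (s : ι) (d : ι →₀ ℕ) :
    MvPowerSeries.coeff d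
        (MvPowerSeries.C (c s) * (MvPowerSeries.X s * zExp c w (k - w s))) =
      d s * MvPowerSeries.coeff d (zExp c w k) := by
  classical
  rw [MvPowerSeries.coeff_C_mul, MvPowerSeries.X, MvPowerSeries.coeff_monomial_mul]
  split_ifs with h
  · obtain ⟨e, rfl⟩ := exists_add_of_le h
    have weight_add : ((Finsupp.single s 1 + e).sum fun s a => (a : ℤ) * w s) =
        w s + e.sum fun s a => (a : ℤ) * w s := by
      rw [Finsupp.sum_add_index' (fun _ => by simp) (fun _ _ _ => by push_cast; ring),
        Finsupp.sum_single_index (by simp), Nat.cast_one, one_mul]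
    have factor_zero (i : ι) : c i ^ 0 / (Nat.factorial 0 : ℂ) = 1 := by simp
    simp only [add_tsub_cancel_left, coeff_zExp, weight_add, eq_sub_iff_add_eq']
    split_ifs
    · rw [← Finsupp.mul_prod_erase' e s (fun s (a : ℕ) => c s ^ a / (a.factorial : ℂ)) factor_zero,
        ← Finsupp.mul_prod_erase' (Finsupp.single s 1 + e) s
          (fun s (a : ℕ) => c s ^ a / (a.factorial : ℂ)) factor_zero, Finsupp.erase_add,
        Finsupp.erase_single, zero_add, Finsupp.add_apply, Finsupp.single_eq_same,
        add_comm 1 (e s), Nat.factorial_succ, pow_succ]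
      push_cast
      have : (e s : ℂ) + 1 ≠ 0 := Nat.cast_add_one_ne_zero _
      field_simp
    · simp only [mul_zero]
  · have h0 : d s = 0 := by
      by_contra h0
      exact h (Finsupp.single_le_iff.mpr (Nat.one_le_iff_ne_zero.mpr h0))
    rw [h0, mul_zero, Nat.cast_zero, zero_mul]

/-- The Euler operators `t_s ∂/∂t_s` annihilate the restriction of
`exp (∑ s, c s * z ^ (w s) * (t_s - t'_s))` to the diagonal, so only its constant term remains. -/
theorem diag_zExp (c : ι → ℂ) (w : ι → ℤ) :
    (fun k => diag (zExp (Sum.elim c (-c)) (Sum.elim w w) k)) = Pi.single 0 1 := by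
  classical
  funext k
  set E := zExp (Sum.elim c (-c)) (Sum.elim w w)
  ext d
  by_cases hd : d = 0
  · rw [hd, MvPowerSeries.coeff_zero_eq_constantCoeff_apply, diag,
      MvPowerSeries.constantCoeff_rename, ← MvPowerSeries.coeff_zero_eq_constantCoeff_apply,
      coeff_zExp, Finsupp.prod_zero_index, Finsupp.sum_zero_index, Pi.single_apply,
      apply_ite (MvPowerSeries.coeff 0), MvPowerSeries.coeff_zero_one, map_zero]
    simp only [eq_comm]
  obtain ⟨s, hs⟩ := Finsupp.ne_iff.mp hd
  have euler : MvPowerSeries.coeff d (diag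
      (MvPowerSeries.C (c s) * (MvPowerSeries.X (Sum.inl s) * E (k - w s)) +
        MvPowerSeries.C (-c s) * (MvPowerSeries.X (Sum.inr s) * E (k - w s)))) =
      d s * MvPowerSeries.coeff d (diag (E k)) := by
    rw [diag, MvPowerSeries.coeff_rename, MvPowerSeries.coeff_rename, Finset.mul_sum]
    refine Finset.sum_congr rfl fun x hx => ?_
    obtain rfl : x.mapDomain (Sum.elim id id) = d := by simpa using hx
    rw [map_add, mapDomain_fold_apply, Nat.cast_add, add_mul]
    exact congrArg₂ _
      (coeff_C_mul_X_mul_zExp (Sum.elim c (-c)) (Sum.elim w w) k (Sum.inl s) x)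
      (coeff_C_mul_X_mul_zExp (Sum.elim c (-c)) (Sum.elim w w) k (Sum.inr s) x)
  have cancel : diag (MvPowerSeries.C (c s) * (MvPowerSeries.X (Sum.inl s) * E (k - w s)) +
      MvPowerSeries.C (-c s) * (MvPowerSeries.X (Sum.inr s) * E (k - w s))) = 0 := by
    simp only [diag, map_add, map_mul, MvPowerSeries.rename_C, MvPowerSeries.rename_X,
      Sum.elim_inl, Sum.elim_inr, map_neg, id_eq, neg_mul, add_neg_cancel]
  have hzero : MvPowerSeries.coeff d (diag (E k)) = 0 := by
    rw [cancel, map_zero, eq_comm] at euler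
    exact (mul_eq_zero.mp euler).resolve_left (Nat.cast_ne_zero.mpr hs)
  rw [hzero, Pi.single_apply, apply_ite (MvPowerSeries.coeff d), MvPowerSeries.coeff_one,
    if_neg hd, map_zero, ite_self]

theorem diag_zMul_zExp (c : ι → ℂ) (w : ι → ℤ) (F : ℤ → Ser (ι ⊕ ι)) (n : ℤ) :
    diag (zMul (zExp (Sum.elim c (-c)) (Sum.elim w w)) F n) = diag (F n) := by
  have hmul := (isLocallyFinite_zExp (Sum.elim c (-c)) (Sum.elim w w)).rename_zMul
    (Sum.elim id id) F n
  have hexp := diag_zExp c w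
  rw [diag] at hexp ⊢
  rw [hmul, hexp, single_zero_one_zMul]

end Diagonal

/-! ### Bilinear residues on the diagonal -/

section Residue

theorem coeff_ofPowerSeries {R : Type*} [Semiring R] (f : PowerSeries R) (n : ℤ) :
    (HahnSeries.ofPowerSeries ℤ R f).coeff n =
      if 0 ≤ n then PowerSeries.coeff n.toNat f else 0 := by
  split_ifs with h
  · lift n to ℕ using h
    exact HahnSeries.ofPowerSeries_apply_coeff f n
  · rw [HahnSeries.ofPowerSeries_apply]
    refine HahnSeries.embDomain_of_notMem_range ?_
    rintro ⟨k, rfl⟩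
    exact h (Int.natCast_nonneg k)

theorem finsum_map_coeff_mul_coeff {R A : Type*} [Semiring R] [AddCommMonoid A] (φ : R →+ A)
    (F G : LaurentSeries R) (n : ℤ) :
    ∑ᶠ k, φ (F.coeff k * G.coeff (n - k)) = φ ((F * G).coeff n) := by
  classical
  set s := Finset.antidiagonal F.isPWO_support G.isPWO_support n
  have fst_injOn : Set.InjOn Prod.fst (s : Set (ℤ × ℤ)) := fun p hp q hq h => by
    have hp := (Finset.mem_antidiagonal.mp hp).2.2
    have hq := (Finset.mem_antidiagonal.mp hq).2.2
    exact Prod.ext h (by lia)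
  rw [HahnSeries.coeff_mul, map_sum, finsum_eq_sum_of_support_subset (s := s.image Prod.fst),
    Finset.sum_image fst_injOn]
  · refine Finset.sum_congr rfl fun p hp => ?_
    rw [← (Finset.mem_antidiagonal.mp hp).2.2, add_sub_cancel_left]
  · intro k hk
    have hFG : F.coeff k * G.coeff (n - k) ≠ 0 := fun h => hk (by simp only [h, map_zero])
    exact Finset.mem_image_of_mem Prod.fst (a := (k, n - k)) (Finset.mem_antidiagonal.mpr
      ⟨left_ne_zero_of_mul hFG, right_ne_zero_of_mul hFG, add_sub_cancel k n⟩)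

theorem zMul_coeff {ι : Type} {s : ℤ} (hs : s * s = 1) (F G : LaurentSeries (Ser ι)) (n : ℤ) :
    zMul (fun k => F.coeff (s * k)) (fun k => G.coeff (s * k)) n = (F * G).coeff (s * n) := by
  have mul_mul_self (k : ℤ) : s * (s * k) = k := by rw [← mul_assoc, hs, one_mul]
  have mul_involutive : Function.Involutive (s * ·) := mul_mul_self
  ext d
  rw [coeff_zMul, ← AddMonoidHom.coe_coe (MvPowerSeries.coeff d), ← finsum_map_coeff_mul_coeff,
    ← finsum_comp_equiv mul_involutive.toPerm]
  simp only [Function.Involutive.coe_toPerm, mul_sub, mul_mul_self]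

theorem locExp_mul_self (i : Fin 3) : locExp i * locExp i = 1 := by
  fin_cases i <;> rfl

/-- `f (t + ε [y]_i)` as a series in `y`. -/
def miwaSer (ε : ℂ) (i : Fin 3) (f : Ser Var) : LaurentSeries (Ser Var) :=
  HahnSeries.ofPowerSeries ℤ (Ser Var) (PowerSeries.mk fun j => miwaCoeff ε i j f)

theorem coeff_miwaSer (ε : ℂ) (i : Fin 3) (f : Ser Var) (n : ℤ) :
    (miwaSer ε i f).coeff n = if 0 ≤ n then miwaCoeff ε i n.toNat f else 0 := by
  rw [miwaSer, coeff_ofPowerSeries, PowerSeries.coeff_mk]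

theorem miwa_eq_coeff (ε : ℂ) (i : Fin 3) (f : Ser Var) (n : ℤ) :
    miwa ε i f n = (miwaSer ε i f).coeff (locExp i * n) := by
  rw [coeff_miwaSer, miwa]

theorem expXiDiff_eq (i : Fin 3) : expXiDiff i =
    zExp (Sum.elim (fun s => if s.1 = i then 1 else 0) (-fun s => if s.1 = i then 1 else 0))
      (Sum.elim (fun s => -locExp i * (s.2 : ℕ)) (fun s => -locExp i * (s.2 : ℕ))) := by
  have ite_neg (s : Var) : (if s.1 = i then -1 else 0 : ℂ) = -if s.1 = i then 1 else 0 := by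
    rw [apply_ite Neg.neg, neg_zero]
  simp only [expXiDiff, ite_neg, Pi.neg_def]

theorem diag_bilinearRes (i : Fin 3) (N : ℤ) (f g : Ser Var) :
    diag (bilinearRes i N f g) =
      (miwaSer (-1) i f * miwaSer 1 i g).coeff (locExp i * (-1 - N)) := by
  let inl : Ser Var →ₐ[ℂ] Ser (Var ⊕ Var) := MvPowerSeries.rename Function.Embedding.inl
  let inr : Ser Var →ₐ[ℂ] Ser (Var ⊕ Var) := MvPowerSeries.rename Function.Embedding.inr
  have hprod := zMul_coeff (locExp_mul_self i) ((miwaSer (-1) i f).map inl)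
    ((miwaSer 1 i g).map inr) (-1 - N)
  have hmap : (((miwaSer (-1) i f).map inl * (miwaSer 1 i g).map inr).map
      diag.toRingHom.toNonUnitalRingHom) =
      miwaSer (-1) i f * miwaSer 1 i g := by
    rw [HahnSeries.map_mul]
    congr 1 <;> ext1 <;> funext n
    · exact diag_rename_inl _
    · exact diag_rename_inr _
  rw [bilinearRes, zPow, expXiDiff_eq, diag_zMul_zExp]
  simp only [miwa_eq_coeff]
  rw [← hmap]
  exact congrArg diag hprod

end Residue

/-! ### Difference operators acting on lattice functions -/

section Action

variable {M N : Type*} [AddCommMonoid M] [Module TField M] [AddCommMonoid N] [Module TField N]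

/-- The value at `m` of `A Φ`, where the difference operator `A` acts on the function `Φ` of the
discrete variables with values in an arbitrary vector space, as an additive function of `A`. -/
def actOn (Φ : Lat → M) (m : Lat) : DiffOp →+ M where
  toFun A := A.sum fun v a => a m • Φ (m + v.toAdd)
  map_zero' := SkewMonoidAlgebra.sum_zero_index
  map_add' _ _ := SkewMonoidAlgebra.sum_add_index' (fun _ => zero_smul _ _)
    fun _ _ _ => add_smul _ _ _

theorem actOn_term (Φ : Lat → M) (m : Lat) (a : Coef) (v : Lat) :
    actOn Φ m (term a v) = a m • Φ (m + v) :=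
  SkewMonoidAlgebra.sum_single_index
    (h := fun (v : Multiplicative Lat) (a : Coef) => a m • Φ (m + v.toAdd)) (zero_smul _ _)

theorem actOn_eq_sum (Φ : Lat → M) (m : Lat) (A : DiffOp) :
    actOn Φ m A = ∑ v ∈ A.support, A.coeff v m • Φ (m + v.toAdd) :=
  SkewMonoidAlgebra.sum_def' A fun (v : Multiplicative Lat) (a : Coef) => a m • Φ (m + v.toAdd)

theorem map_actOn (T : M →ₗ[TField] N) (Φ : Lat → M) (m : Lat) (A : DiffOp) :
    T (actOn Φ m A) = actOn (fun w => T (Φ w)) m A := by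
  simp only [actOn_eq_sum, map_sum, map_smul]

theorem act_apply (A : DiffOp) (Φ : Lat → ℤ → TField) (m : Lat) (n : ℤ) :
    A.act Φ m n = actOn (fun w => Φ w n) m A :=
  rfl

end Action

/-! ### Laurent series of bounded order -/

section Order

/-- The Laurent series all of whose terms have degree at least `c`. -/
def orderGE (R : Type*) [Semiring R] (c : ℤ) : Submodule R (LaurentSeries R) where
  carrier := {f | ∀ n < c, f.coeff n = 0}
  zero_mem' _ _ := rfl
  add_mem' hf hg n hn := by rw [HahnSeries.coeff_add, hf n hn, hg n hn, add_zero]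
  smul_mem' a f hf n hn := by rw [HahnSeries.coeff_smul, hf n hn, smul_zero]

variable {R : Type*} [Semiring R] {a b c n : ℤ} {f g : LaurentSeries R}

theorem mem_orderGE_iff_le_orderTop : f ∈ orderGE R c ↔ (c : WithTop ℤ) ≤ f.orderTop :=
  ⟨fun h => HahnSeries.le_orderTop_iff_forall.mpr fun n hn => h n (WithTop.coe_lt_coe.mp hn),
    fun h n hn => HahnSeries.le_orderTop_iff_forall.mp h n (WithTop.coe_lt_coe.mpr hn)⟩

theorem orderGE_anti (h : a ≤ b) : orderGE R b ≤ orderGE R a :=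
  fun _ hf n hn => hf n (hn.trans_le h)

theorem mem_orderGE_order (f : LaurentSeries R) : f ∈ orderGE R f.order :=
  fun _ hn => HahnSeries.coeff_eq_zero_of_lt_order hn

theorem le_order_of_mem_orderGE (hf : f ∈ orderGE R c) (h0 : f ≠ 0) : c ≤ f.order :=
  not_lt.mp fun h => h0 (HahnSeries.coeff_order_eq_zero.mp (hf _ h))

theorem mul_mem_orderGE (hf : f ∈ orderGE R a) (hg : g ∈ orderGE R b) :
    f * g ∈ orderGE R (a + b) := by
  rw [mem_orderGE_iff_le_orderTop] at *
  rw [WithTop.coe_add]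
  exact (add_le_add hf hg).trans HahnSeries.orderTop_add_le_mul

theorem eq_zero_of_forall_coeff_mul_eq_zero [NoZeroDivisors R] {D : ℤ → LaurentSeries R}
    (hf : f ∈ orderGE R c) (hD : ∀ j, D j ≠ 0) (hord : ∀ j, (D j).order = j)
    (h : ∀ j, c ≤ n - j → (f * D j).coeff n = 0) : f = 0 := by
  by_contra h0
  have hlead := HahnSeries.coeff_mul_order_add_order f (D (n - f.order))
  rw [hord, add_sub_cancel, h _ (by linarith [le_order_of_mem_orderGE hf h0])] at hlead
  exact mul_ne_zero (HahnSeries.leadingCoeff_ne_zero.mpr h0)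
    (HahnSeries.leadingCoeff_ne_zero.mpr (hD _)) hlead.symm

end Order

/-! ### Parts of pseudo-difference operators -/

section Term

theorem term_zero (v : Lat) : term 0 v = 0 := SkewMonoidAlgebra.single_zero _

theorem term_sum {κ : Type*} (s : Finset κ) (a : κ → Coef) (v : Lat) :
    term (∑ i ∈ s, a i) v = ∑ i ∈ s, term (a i) v :=
  map_sum (SkewMonoidAlgebra.singleAddHom (Multiplicative.ofAdd v)) a s

theorem term_nsmul (n : ℕ) (a : Coef) (v : Lat) : term (n • a) v = n • term a v :=
  map_nsmul (SkewMonoidAlgebra.singleAddHom (Multiplicative.ofAdd v)) n a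

theorem term_mul_term_one (a : Coef) (v w : Lat) : term a v * term 1 w = term a (v + w) := by
  rw [term, term, SkewMonoidAlgebra.single_mul_single, smul_one, mul_one, ← ofAdd_add, ← term]

theorem term_one_pow (v : Lat) (n : ℕ) : term 1 v ^ n = term 1 (n • v) := by
  induction n with
  | zero => rw [zero_smul, pow_zero]; rfl
  | succ n ih => rw [pow_succ, ih, term_mul_term_one, succ_nsmul]

theorem sum_range_choose_nsmul_sub_one_pow {R : Type*} [Ring R] (x : R) {i n : ℕ} (h : i < n) :
    ∑ p ∈ Finset.range n, i.choose p • (x - 1) ^ p = x ^ i := by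
  conv_rhs => rw [← sub_add_cancel x 1, (Commute.one_right (x - 1)).add_pow]
  simp only [one_pow, mul_one, nsmul_eq_mul']
  symm
  refine Finset.sum_subset (Finset.range_mono h) fun p _ hp => ?_
  rw [Nat.choose_eq_zero_of_lt (by simpa using hp), Nat.cast_zero, mul_zero]

end Term

section Parts

variable {v : Lat}

theorem partLE_eq_sum (A : PDO v) {M : ℤ} (hM : ∀ j < M, A.coeff j = 0) (n : ℤ) :
    A.partLE n = ∑ j ∈ Finset.Icc M n, term (A.coeff j) (j • v) := by
  rw [PDO.partLE, finsum_eq_sum_of_support_subset (s := Finset.Icc M n)]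
  · exact Finset.sum_congr rfl fun j hj => if_pos (Finset.mem_Icc.mp hj).2
  · intro j hj
    obtain ⟨hn, hne⟩ := ite_ne_right_iff.mp hj
    refine Finset.mem_coe.mpr (Finset.mem_Icc.mpr ⟨not_lt.mp fun h => hne ?_, hn⟩)
    rw [hM j h, term_zero]

theorem partLE_zero_eq_sum (A : PDO v) {N : ℕ} (hN : ∀ j < -(N : ℤ), A.coeff j = 0) :
    A.partLE 0 =
      ∑ i ∈ Finset.range (N + 1), term (A.coeff (-(i : ℤ))) (-(i : ℤ) • v) := by
  rw [partLE_eq_sum A hN]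
  refine Finset.sum_nbij' (fun j => (-j).toNat) (fun i => -(i : ℤ)) ?_ ?_ ?_ ?_ ?_
  all_goals simp only [Finset.mem_Icc, Finset.mem_range]; intro i hi
  any_goals lia
  rw [show -((-i).toNat : ℤ) = i by lia]

theorem exists_natCast_bound (A : PDO v) : ∃ N : ℕ, ∀ j < -(N : ℤ), A.coeff j = 0 := by
  obtain ⟨M, hM⟩ := A.bddBelow
  exact ⟨(-M).toNat, fun j hj => hM j (by lia)⟩

theorem deltaCoeff_eq_sum (A : PDO v) {N : ℕ} (hN : ∀ j < -(N : ℤ), A.coeff j = 0) (p : ℕ) :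
    A.deltaCoeff p = ∑ i ∈ Finset.range (N + 1), i.choose p • A.coeff (-(i : ℤ)) := by
  have sum_Ico : ∑ i ∈ Finset.Ico p (N + 1), i.choose p • A.coeff (-(i : ℤ)) =
      ∑ i ∈ Finset.range (N + 1), i.choose p • A.coeff (-(i : ℤ)) := by
    rw [Finset.range_eq_Ico]
    refine Finset.sum_subset (Finset.Ico_subset_Ico_left p.zero_le) fun i hi hi' => ?_
    rw [Finset.mem_Ico] at hi hi'
    rw [Nat.choose_eq_zero_of_lt (by lia), zero_smul]
  rw [← sum_Ico, Finset.sum_Ico_eq_sum_range, PDO.deltaCoeff,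
    finsum_eq_sum_of_support_subset (s := Finset.range (N + 1 - p))]
  · refine Finset.sum_congr rfl fun j _ => ?_
    rw [← Nat.cast_add, Ring.choose_natCast, natCast_zsmul, ← Nat.choose_symm_add]
  · intro j hj
    rw [Finset.coe_range, Set.mem_Iio]
    by_contra h
    refine hj ?_
    simp only [hN (-((p : ℤ) + j)) (by lia), smul_zero]

theorem deltaCoeff_eq_zero_of_lt (A : PDO v) {N p : ℕ} (hN : ∀ j < -(N : ℤ), A.coeff j = 0)
    (hp : N < p) : A.deltaCoeff p = 0 := by
  rw [deltaCoeff_eq_sum A hN]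
  refine Finset.sum_eq_zero fun i hi => ?_
  rw [Finset.mem_range] at hi
  rw [Nat.choose_eq_zero_of_lt (by lia), zero_smul]

theorem sum_deltaCoeff_mul_pow (A : PDO v) {N : ℕ} (hN : ∀ j < -(N : ℤ), A.coeff j = 0) :
    ∑ p ∈ Finset.range (N + 1), term (A.deltaCoeff p) 0 * (term 1 (-v) - 1) ^ p =
      A.partLE 0 := by
  simp only [partLE_zero_eq_sum A hN, deltaCoeff_eq_sum A hN, term_sum, term_nsmul,
    Finset.sum_mul]
  rw [Finset.sum_comm]
  refine Finset.sum_congr rfl fun i hi => ?_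
  have exponent : -(i : ℤ) • v = 0 + i • -v := by simp
  rw [exponent, ← term_mul_term_one, ← term_one_pow,
    ← sum_range_choose_nsmul_sub_one_pow _ (Finset.mem_range.mp hi), Finset.mul_sum]
  exact Finset.sum_congr rfl fun p _ => by rw [nsmul_eq_mul', nsmul_eq_mul, mul_assoc]

theorem deltaPartPos_eq (A : PDO v) :
    A.deltaPartPos = A.partLE 0 - term (A.deltaCoeff 0) 0 := by
  obtain ⟨N, hN⟩ := exists_natCast_bound A
  rw [PDO.deltaPartPos, finsum_eq_sum_of_support_subset (s := Finset.range (N + 1)),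
    ← sum_deltaCoeff_mul_pow A hN, Finset.sum_range_succ', Finset.sum_range_succ']
  · simp
  · intro p hp
    rw [Finset.coe_range, Set.mem_Iio]
    by_contra h
    refine hp ?_
    simp only [deltaCoeff_eq_zero_of_lt A hN (show N < p by lia), term_zero, zero_mul, ite_self]

theorem deltaPartPos_eq_sum (A : PDO v) {N : ℕ} (hN : ∀ j < -(N : ℤ), A.coeff j = 0) :
    A.deltaPartPos = ∑ i ∈ Finset.range (N + 1),
      (term (A.coeff (-(i : ℤ))) (-(i : ℤ) • v) - term (A.coeff (-(i : ℤ))) 0) := by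
  have deltaCoeff_zero := deltaCoeff_eq_sum A hN 0
  simp only [Nat.cast_zero, Nat.choose_zero_right, one_smul] at deltaCoeff_zero
  rw [deltaPartPos_eq, partLE_zero_eq_sum A hN, deltaCoeff_zero, term_sum,
    Finset.sum_sub_distrib]

theorem mul_mono_neg_one_pow_coeff (A : PDO v) (k : ℕ) (j : ℤ) :
    (A * PDO.mono v (-1) 1 ^ k).coeff j = A.coeff (j + k) := by
  induction k generalizing j with
  | zero => rw [pow_zero, mul_one, Nat.cast_zero, add_zero]
  | succ k ih =>
    rw [pow_succ, ← mul_assoc, PDO.mul_coeff, PDO.mulCoeff, finsum_eq_single _ (j + 1)]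
    · rw [ih, PDO.mono]
      simp only
      rw [if_pos (by lia), PDO.sh_one', mul_one, Nat.cast_succ, add_assoc, add_comm 1]
    · intro i hi
      rw [PDO.mono]
      simp only
      rw [if_neg (by lia), PDO.sh_zero', mul_zero]

theorem dress_pow_mul {S : PDO v} (hS : IsUnit S) (k : ℕ) :
    dress S ^ k * S = S * PDO.mono v (-1) 1 ^ k := by
  induction k with
  | zero => rw [pow_zero, pow_zero, one_mul, mul_one]
  | succ k ih =>
    rw [pow_succ, mul_assoc, dress, mul_assoc (S * _), Ring.inverse_mul_cancel S hS, mul_one,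
      ← dress, ← mul_assoc, ih, mul_assoc, ← pow_succ]

end Parts

/-! ### Symbols -/

section PartsActing

variable {M : Type*} [AddCommGroup M] [Module TField M] {v : Lat} {Φ : Lat → M}
  {P : Submodule TField M} {m : Lat}

theorem actOn_partLE_mem (A : PDO v) {n : ℤ} (h : ∀ j ≤ n, Φ (m + j • v) ∈ P) :
    actOn Φ m (A.partLE n) ∈ P := by
  obtain ⟨M, hM⟩ := A.bddBelow
  rw [partLE_eq_sum A hM, map_sum]
  refine Submodule.sum_mem _ fun j hj => ?_
  rw [actOn_term]
  exact P.smul_mem _ (h j (Finset.mem_Icc.mp hj).2)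

theorem actOn_deltaPartPos_mem (A : PDO v) (h : ∀ j ≤ (0 : ℤ), Φ (m + j • v) - Φ m ∈ P) :
    actOn Φ m A.deltaPartPos ∈ P := by
  obtain ⟨N, hN⟩ := exists_natCast_bound A
  rw [deltaPartPos_eq_sum A hN, map_sum]
  refine Submodule.sum_mem _ fun i _ => ?_
  rw [map_sub, actOn_term, actOn_term, add_zero, ← smul_sub]
  exact P.smul_mem _ (h _ (neg_nonpos.mpr (Int.natCast_nonneg i)))

end PartsActing

section Symbol

variable {v : Lat} {χ : Lat →+ ℤ} {S : PDO v}

/-- The value at `m` of `A (y ^ χ)`. If `χ v = 1`, then the shift `x = Λ ^ v` multiplies the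
function `y ^ χ` by `y`, so this is a Laurent series in `y`. -/
def symbol (χ : Lat →+ ℤ) (A : PDO v) (m : Lat) : LaurentSeries TField :=
  HahnSeries.ofSuppBddBelow (fun n => A.coeff (n - χ m) m) <| by
    obtain ⟨N, hN⟩ := A.bddBelow
    refine ⟨N + χ m, fun n hn => le_of_not_gt fun h => hn ?_⟩
    simp only [hN (n - χ m) (by lia), Pi.zero_apply]

theorem coeff_symbol (A : PDO v) (m : Lat) (n : ℤ) :
    (symbol χ A m).coeff n = A.coeff (n - χ m) m :=
  rfl

theorem symbol_mem_orderGE (hS : ∀ j < 0, S.coeff j = 0) (m : Lat) :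
    symbol χ S m ∈ orderGE TField (χ m) :=
  fun n hn => by rw [coeff_symbol, hS _ (by lia), Pi.zero_apply]

theorem actOn_symbol_partLE_sub_mem (hχ : χ v = 1) (hS : ∀ j < 0, S.coeff j = 0) (A : PDO v)
    (n : ℤ) (m : Lat) :
    actOn (symbol χ S) m (A.partLE n) - symbol χ (A * S) m ∈ orderGE TField (χ m + n + 1) := by
  intro p hp
  obtain ⟨M, hM⟩ := A.bddBelow
  have mul_coeff := PDO.mulCoeff_eq (v := v) hM hS (p - χ m) (Finset.Icc M n)
    (Finset.Icc_subset_Icc_right (by lia))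
  rw [HahnSeries.coeff_sub, sub_eq_zero, partLE_eq_sum A hM, map_sum, HahnSeries.coeff_sum,
    coeff_symbol, PDO.mul_coeff, mul_coeff, Finset.sum_apply]
  refine Finset.sum_congr rfl fun j _ => ?_
  rw [actOn_term, HahnSeries.coeff_smul, coeff_symbol, map_add, map_zsmul, hχ, smul_eq_mul,
    smul_eq_mul, mul_one, ← sub_sub]
  rfl

theorem actOn_symbol_deltaPartPos_sub_mem (hχ : χ v = 1) (hS : ∀ j < 0, S.coeff j = 0)
    (A : PDO v) (m : Lat) :
    actOn (symbol χ S) m A.deltaPartPos - symbol χ (A * S) m ∈ orderGE TField (χ m) := by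
  rw [deltaPartPos_eq, map_sub, actOn_term, add_zero, sub_right_comm]
  exact Submodule.sub_mem _
    (orderGE_anti (by lia) (actOn_symbol_partLE_sub_mem hχ hS A 0 m))
    (Submodule.smul_mem _ _ (symbol_mem_orderGE hS m))

theorem symbol_dress_pow_mul (hS : IsUnit S) (k : ℕ) (m : Lat) :
    symbol χ (dress S ^ k * S) m = HahnSeries.single (-(k : ℤ)) 1 * symbol χ S m := by
  ext n
  rw [HahnSeries.coeff_single_mul, one_mul, coeff_symbol, coeff_symbol, dress_pow_mul hS,
    mul_mono_neg_one_pow_coeff, sub_neg_eq_add, sub_add_eq_add_sub]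

end Symbol

/-! ### The residue pairing -/

section ResiduePairing

/-- The function `m ↦ N` for which the `i`-th wave function starts with the power `y_i ^ N`. -/
def deg : Fin 3 → Lat →+ ℤ :=
  ![-AddMonoidHom.fst ℤ ℤ, AddMonoidHom.snd ℤ ℤ,
    AddMonoidHom.fst ℤ ℤ - AddMonoidHom.snd ℤ ℤ]

theorem deg_zero_apply (m : Lat) : deg 0 m = -m.1 := rfl

theorem deg_one_apply (m : Lat) : deg 1 m = m.2 := rfl

theorem deg_two_apply (m : Lat) : deg 2 m = m.1 - m.2 := rfl

/-- The sum of the residues of `F_i D_i dz` at `z = ∞, 0, 0` for `i = 0, 1, 2`, where `F_i` and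
`D_i` are Laurent series in the local parameter `y_i`. -/
def resPairing (D : Fin 3 → LaurentSeries TField) :
    (Fin 3 → LaurentSeries TField) →ₗ[TField] TField where
  toFun F := ∑ i, locExp i • (F i * D i).coeff (-locExp i)
  map_add' F G := by
    simp only [Pi.add_apply, add_mul, HahnSeries.coeff_add, smul_add, Finset.sum_add_distrib]
  map_smul' a F := by
    simp only [Pi.smul_apply, ← HahnSeries.single_zero_mul_eq_smul, mul_assoc,
      HahnSeries.coeff_single_zero_mul, mul_smul_comm, smul_eq_mul, Finset.mul_sum,
      RingHom.id_apply]

theorem resPairing_apply (D F : Fin 3 → LaurentSeries TField) :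
    resPairing D F = ∑ i, locExp i • (F i * D i).coeff (-locExp i) :=
  rfl

theorem resPairing_eq_zero_iff (D F : Fin 3 → LaurentSeries TField) :
    resPairing D F = 0 ↔
      (F 0 * D 0).coeff 1 = (F 1 * D 1).coeff (-1) + (F 2 * D 2).coeff (-1) := by
  rw [resPairing_apply, Fin.sum_univ_three, add_assoc, ← sub_neg_eq_add _ (_ + _), sub_eq_zero]
  simp [locExp, neg_eq_iff_eq_neg]

/-- The error terms allowed when the wave functions at `m` are matched: `F_i` has order at least
`deg i m`, and greater than that for `i = 0`. -/
def remainder (m : Lat) : Submodule TField (Fin 3 → LaurentSeries TField) :=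
  Submodule.pi Set.univ fun i => orderGE TField (deg i m + if i = 0 then 1 else 0)

theorem mem_remainder {m : Lat} {F : Fin 3 → LaurentSeries TField} :
    F ∈ remainder m ↔ ∀ i, F i ∈ orderGE TField (deg i m + if i = 0 then 1 else 0) := by
  simp [remainder]

theorem eq_zero_of_resPairing_eq_zero {D : Lat → Fin 3 → LaurentSeries TField} {m : Lat}
    {F : Fin 3 → LaurentSeries TField} (hD : ∀ m' i, D m' i ≠ 0)
    (hord : ∀ m' i, (D m' i).order = -deg i m') (hF : F ∈ remainder m)
    (h : ∀ m', resPairing (D m') F = 0) : F = 0 := by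
  simp only [resPairing_eq_zero_iff] at h
  rw [mem_remainder] at hF
  have coeff_eq_zero {i : Fin 3} (m' : Lat) {n : ℤ}
      (hn : n < (deg i m + if i = 0 then 1 else 0) - deg i m') : (F i * D m' i).coeff n = 0 :=
    mul_mem_orderGE (hF i) (mem_orderGE_order (D m' i)) n (by rw [hord]; lia)
  have F_zero : F 0 = 0 := by
    refine eq_zero_of_forall_coeff_mul_eq_zero (n := 1) (D := fun j => D (j, m.2) 0) (hF 0)
      (fun _ => hD _ _) (fun j => by rw [hord, deg_zero_apply, neg_neg]) fun j hj => ?_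
    rw [h, coeff_eq_zero, coeff_eq_zero, add_zero]
    all_goals
      simp only [deg_zero_apply, deg_one_apply, deg_two_apply, if_true, one_ne_zero,
        if_false] at hj ⊢
      lia
  simp only [F_zero, zero_mul, HahnSeries.coeff_zero] at h
  have F_one : F 1 = 0 := by
    refine eq_zero_of_forall_coeff_mul_eq_zero (n := -1) (D := fun j => D (m.1, -j) 1) (hF 1)
      (fun _ => hD _ _) (fun j => by rw [hord, deg_one_apply, neg_neg]) fun j hj => ?_
    rw [eq_neg_of_add_eq_zero_left (h _).symm, coeff_eq_zero, neg_zero]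
    simp only [deg_one_apply, deg_two_apply, one_ne_zero, if_false] at hj ⊢
    lia
  simp only [F_one, zero_mul, HahnSeries.coeff_zero, zero_add] at h
  have F_two : F 2 = 0 :=
    eq_zero_of_forall_coeff_mul_eq_zero (n := -1) (D := fun j => D (-j, 0) 2) (hF 2)
      (fun _ => hD _ _) (fun j => by rw [hord, deg_two_apply, sub_zero, neg_neg])
      fun j _ => (h _).symm
  exact funext (Fin.forall_fin_succ.mpr ⟨F_zero, Fin.forall_fin_two.mpr ⟨F_one, F_two⟩⟩)

end ResiduePairing

/-! ### Wave functions without their exponential factors -/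

section ScaledMiwa

/-- The Laurent series `a y ^ N f (t + ε [y]_i)` with coefficients in the field of fractions. -/
def scaledMiwa (N : ℤ) (a : TField) (ε : ℂ) (i : Fin 3) (f : Ser Var) : LaurentSeries TField :=
  HahnSeries.single N a * (miwaSer ε i f).map (algebraMap (Ser Var) TField)

variable {M N : ℤ} {a b : TField} {ε : ℂ} {i : Fin 3} {f g : Ser Var}

theorem coeff_scaledMiwa (n : ℤ) : (scaledMiwa N a ε i f).coeff n =
    a * algebraMap (Ser Var) TField ((miwaSer ε i f).coeff (n - N)) := by
  rw [scaledMiwa, HahnSeries.coeff_single_mul]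
  rfl

theorem coeff_scaledMiwa_self :
    (scaledMiwa N a ε i f).coeff N = a * algebraMap (Ser Var) TField f := by
  rw [coeff_scaledMiwa, sub_self, coeff_miwaSer, if_pos le_rfl, Int.toNat_zero, miwaCoeff_zero]

theorem scaledMiwa_mem_orderGE : scaledMiwa N a ε i f ∈ orderGE TField N := fun n hn => by
  rw [coeff_scaledMiwa, coeff_miwaSer, if_neg (by lia), map_zero, mul_zero]

theorem coeff_scaledMiwa_self_ne_zero (ha : a ≠ 0) (hf : f ≠ 0) :
    (scaledMiwa N a ε i f).coeff N ≠ 0 := by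
  rw [coeff_scaledMiwa_self]
  exact mul_ne_zero ha (mt IsFractionRing.to_map_eq_zero_iff.mp hf)

theorem scaledMiwa_ne_zero (ha : a ≠ 0) (hf : f ≠ 0) : scaledMiwa N a ε i f ≠ 0 :=
  HahnSeries.ne_zero_of_coeff_ne_zero (coeff_scaledMiwa_self_ne_zero ha hf)

theorem order_scaledMiwa (ha : a ≠ 0) (hf : f ≠ 0) : (scaledMiwa N a ε i f).order = N :=
  le_antisymm (HahnSeries.order_le_of_coeff_ne_zero (coeff_scaledMiwa_self_ne_zero ha hf))
    (le_order_of_mem_orderGE scaledMiwa_mem_orderGE (scaledMiwa_ne_zero ha hf))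

theorem coeff_single_mul_scaledMiwa_mul_scaledMiwa (k : ℤ) :
    (HahnSeries.single k 1 * scaledMiwa M a (-1) i f * scaledMiwa N b 1 i g).coeff (-locExp i) =
      a * b * algebraMap (Ser Var) TField (diag (bilinearRes i (locExp i * (k + M + N)) f g)) := by
  have factor : HahnSeries.single k 1 * scaledMiwa M a (-1) i f * scaledMiwa N b 1 i g =
      HahnSeries.single (k + M + N) (a * b) *
        (miwaSer (-1) i f * miwaSer 1 i g).map
          (algebraMap (Ser Var) TField).toNonUnitalRingHom := by
    rw [HahnSeries.map_mul, ← one_mul a, ← HahnSeries.single_mul_single,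
      ← HahnSeries.single_mul_single, one_mul, scaledMiwa, scaledMiwa, mul_assoc, mul_assoc,
      mul_assoc, mul_assoc, mul_left_comm (HahnSeries.map _ _)]
    rfl
  rw [factor, HahnSeries.coeff_single_mul, diag_bilinearRes, mul_sub, ← mul_assoc,
    locExp_mul_self, one_mul, mul_neg_one]
  rfl

end ScaledMiwa

section BareWave

/-- The shift of `m` in the numerator of the `i`-th wave function. -/
def shift : Fin 3 → Lat := ![0, (1, 1), (1, 0)]

/-- The sign in front of the `i`-th wave function. -/
def sign (i : Fin 3) (m : Lat) : TField := ![1, 1, (-1) ^ m.2] i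

theorem sign_ne_zero (i : Fin 3) (m : Lat) : sign i m ≠ 0 := by
  fin_cases i
  · exact one_ne_zero
  · exact one_ne_zero
  · exact zpow_ne_zero _ (neg_ne_zero.mpr one_ne_zero)

variable (τ : Lat → Ser Var)

/-- The wave functions without their exponential factors, as Laurent series in the local
parameters `y_i`. -/
def bareWave (m : Lat) (i : Fin 3) : LaurentSeries TField :=
  scaledMiwa (deg i m) (sign i m / algebraMap (Ser Var) TField (τ m)) (-1) i (τ (m + shift i))

/-- The adjoint wave functions without their exponential factors and denominators, as Laurent
series in the local parameters `y_i`. -/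
def dualWave (m : Lat) (i : Fin 3) : LaurentSeries TField :=
  scaledMiwa (-deg i m) (sign i m) 1 i (τ (m - shift i))

theorem bareWave_mem_orderGE (m : Lat) (i : Fin 3) : bareWave τ m i ∈ orderGE TField (deg i m) :=
  scaledMiwa_mem_orderGE

/-- The coefficients of the `i`-th wave operator, applied in the direction `v`; the wave operators
`S₁ (Λ₁)`, `S₂ (Λ₂)`, `S₃ (Λ₁)`, `S₃ (Λ₂⁻¹)` are `waveOp τ i v` for `i = 0, 1, 2, 2` and the four
directions `v` with `deg i v = 1`. -/
def waveOp (i : Fin 3) (v : Lat) : PDO v :=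
  PDO.ofSeq v fun k m => sign i m * waveCoeff i (fun m => τ (m + shift i)) τ k m

theorem waveOp_coeff_of_neg {i : Fin 3} {v : Lat} : ∀ j < 0, (waveOp τ i v).coeff j = 0 :=
  fun _ hj => if_neg (not_le.mpr hj)

theorem symbol_waveOp (i : Fin 3) (v : Lat) :
    symbol (deg i) (waveOp τ i v) = fun m => bareWave τ m i := by
  ext m n
  rw [bareWave, coeff_scaledMiwa, coeff_symbol, waveOp, PDO.ofSeq_coeff, coeff_miwaSer]
  split_ifs
  · simp only [waveCoeff, mul_div_assoc', div_mul_eq_mul_div]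
  · rw [map_zero, mul_zero, Pi.zero_apply]

theorem S1_eq_waveOp : S1 τ = waveOp τ 0 (-1, 0) := by
  simp only [S1, waveOp, sign, shift, Matrix.cons_val_zero, add_zero, one_mul]

theorem S2_eq_waveOp : S2 τ = waveOp τ 1 (0, 1) := by
  simp only [S2, waveOp, sign, shift, Matrix.cons_val_one, Matrix.cons_val_zero, one_mul]

theorem S3_eq_waveOp : S3 τ = waveOp τ 2 (1, 0) :=
  rfl

theorem S3'_eq_waveOp : S3' τ = waveOp τ 2 (0, -1) :=
  rfl

variable {τ}

theorem isUnit_waveOp (hτ : ∀ m, τ m ≠ 0) (i : Fin 3) (v : Lat) : IsUnit (waveOp τ i v) :=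
  PDO.isUnit_ofSeq _ fun m =>
    mul_ne_zero (sign_ne_zero i m) (waveCoeff_zero_ne i _ τ (fun _ => hτ _) hτ m)

theorem bareWave_zero_sub_mem_orderGE (hτ : ∀ m, τ m ≠ 0) {m w : Lat} (h : deg 0 w = deg 0 m) :
    bareWave τ w 0 - bareWave τ m 0 ∈ orderGE TField (deg 0 m + 1) := by
  have leading (m : Lat) : (bareWave τ m 0).coeff (deg 0 m) = 1 := by
    rw [bareWave, coeff_scaledMiwa_self]
    simp only [sign, shift, Matrix.cons_val_zero, add_zero]
    exact div_mul_cancel₀ 1 (mt IsFractionRing.to_map_eq_zero_iff.mp (hτ m))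
  intro n hn
  rw [HahnSeries.coeff_sub]
  rcases (Int.lt_add_one_iff.mp hn).lt_or_eq with hlt | rfl
  · rw [bareWave_mem_orderGE τ w 0 n (hlt.trans_eq h.symm), bareWave_mem_orderGE τ m 0 n hlt,
      sub_zero]
  · rw [leading, ← h, leading, sub_self]

theorem algebraMap_neg_one_zpow_smul (k : ℤ) (x : Ser Var) :
    algebraMap (Ser Var) TField ((-1 : ℂ) ^ k • x) =
      (-1 : TField) ^ k * algebraMap (Ser Var) TField x := by
  rcases Int.even_or_odd k with hk | hk
  · rw [hk.neg_one_zpow, hk.neg_one_zpow, one_smul, one_mul]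
  · rw [hk.neg_one_zpow, hk.neg_one_zpow, neg_smul, one_smul, map_neg, neg_one_mul]

variable {n₁ n₂ n₃ : ℕ}

theorem IsKdVTau.resPairing_single_mul_eq_zero (hKdV : IsKdVTau n₁ n₂ n₃ τ) (m m' : Lat)
    (l : ℕ) : resPairing (dualWave τ m')
      (fun i => HahnSeries.single (-(![n₁, n₂, n₃] i * l : ℤ)) 1 * bareWave τ m i) = 0 := by
  have h := congrArg (fun x => algebraMap (Ser Var) TField (diag x)) (hKdV m m' l)
  simp only [map_add, map_smul, algebraMap_neg_one_zpow_smul] at h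
  have exponent_zero : locExp 0 * (-(n₁ * l : ℤ) + deg 0 m + -deg 0 m') = n₁ * l + m.1 - m'.1 := by
    rw [show locExp 0 = -1 from rfl, deg_zero_apply, deg_zero_apply]
    ring
  have exponent_one : locExp 1 * (-(n₂ * l : ℤ) + deg 1 m + -deg 1 m') =
      -(n₂ * l) + m.2 - m'.2 := by
    rw [show locExp 1 = 1 from rfl, deg_one_apply, deg_one_apply]
    ring
  have exponent_two : locExp 2 * (-(n₃ * l : ℤ) + deg 2 m + -deg 2 m') =
      -(n₃ * l) + m.1 - m.2 - m'.1 + m'.2 := by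
    rw [show locExp 2 = 1 from rfl, deg_two_apply, deg_two_apply]
    ring
  rw [resPairing_apply, Fin.sum_univ_three]
  simp only [bareWave, dualWave, coeff_single_mul_scaledMiwa_mul_scaledMiwa]
  simp only [Matrix.cons_val_zero, Matrix.cons_val_one, Matrix.cons_val]
  rw [exponent_zero, exponent_one, exponent_two]
  simp only [shift, sign, Matrix.cons_val_zero, Matrix.cons_val_one, Matrix.cons_val, add_zero,
    sub_zero, h, zpow_add₀ (neg_ne_zero.mpr one_ne_zero : (-1 : TField) ≠ 0)]
  simp only [locExp, Matrix.cons_val_zero, Matrix.cons_val_one, Matrix.cons_val, neg_smul, one_smul]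
  ring

theorem IsKdVTau.resPairing_actOn_sub_eq_zero (hKdV : IsKdVTau n₁ n₂ n₃ τ) (D : DiffOp)
    (m m' : Lat) : resPairing (dualWave τ m') (actOn (bareWave τ) m D -
      fun i => HahnSeries.single (-(![n₁, n₂, n₃] i : ℤ)) 1 * bareWave τ m i) = 0 := by
  have bareWave_zero (w : Lat) : resPairing (dualWave τ m') (bareWave τ w) = 0 := by
    simpa using hKdV.resPairing_single_mul_eq_zero w m' 0
  have shifted_zero := hKdV.resPairing_single_mul_eq_zero m m' 1
  rw [Nat.cast_one] at shifted_zero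
  simp only [mul_one] at shifted_zero
  rw [map_sub, shifted_zero, map_actOn, actOn_eq_sum, sub_zero]
  simp only [bareWave_zero, smul_zero, Finset.sum_const_zero]

end BareWave

/-! ### Parts of the Lax operator -/

section LaxPart

/-- The property of a difference operator which makes it the `i`-th part of a Lax operator: it
multiplies the `i`-th wave function by `y_i ^ (-k)` and annihilates the other ones, up to the
terms allowed by `remainder`. -/
def IsLaxPart (τ : Lat → Ser Var) (i : Fin 3) (k : ℕ) (D : DiffOp) : Prop :=
  ∀ m, actOn (bareWave τ) m D -
    Pi.single i (HahnSeries.single (-(k : ℤ)) 1 * bareWave τ m i) ∈ remainder m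

variable {τ : Lat → Ser Var} {i : Fin 3} {k : ℕ} {D : DiffOp} {v : Lat}

theorem isLaxPart_of_forall
    (h_self : ∀ m, actOn (fun w => bareWave τ w i) m D -
      HahnSeries.single (-(k : ℤ)) 1 * bareWave τ m i ∈
        orderGE TField (deg i m + if i = 0 then 1 else 0))
    (h_other : ∀ j ≠ i, ∀ m, actOn (fun w => bareWave τ w j) m D ∈
      orderGE TField (deg j m + if j = 0 then 1 else 0)) :
    IsLaxPart τ i k D := fun m => mem_remainder.mpr fun j => by
  have hcomponent : actOn (bareWave τ) m D j = actOn (fun w => bareWave τ w j) m D :=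
    map_actOn (LinearMap.proj (φ := fun _ : Fin 3 => LaurentSeries TField) j) (bareWave τ) m D
  rw [Pi.sub_apply, hcomponent]
  by_cases hj : j = i
  · subst hj
    rw [Pi.single_eq_same]
    exact h_self m
  · rw [Pi.single_eq_of_ne hj, sub_zero]
    exact h_other j hj m

theorem isLaxPart_partLE (hτ : ∀ m, τ m ≠ 0) (hv : deg i v = 1) {n : ℤ}
    (hn : (if i = 0 then 1 else 0) ≤ n + 1)
    (hother : ∀ j ≠ i, deg j v ≤ 0 ∧ (if j = 0 then 1 else 0) ≤ n * deg j v) (k : ℕ) :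
    IsLaxPart τ i k ((dress (waveOp τ i v) ^ k).partLE n) := by
  refine isLaxPart_of_forall (fun m => ?_) fun j hj m => actOn_partLE_mem _ fun l hl => ?_
  · have key := actOn_symbol_partLE_sub_mem hv (waveOp_coeff_of_neg τ (i := i))
      (dress (waveOp τ i v) ^ k) n m
    rw [symbol_dress_pow_mul (isUnit_waveOp hτ i v), symbol_waveOp] at key
    exact orderGE_anti (by lia) key
  · obtain ⟨hle, hge⟩ := hother j hj
    refine orderGE_anti ?_ (bareWave_mem_orderGE τ _ j)
    rw [map_add, map_zsmul, smul_eq_mul]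
    exact add_le_add_right (hge.trans (mul_le_mul_of_nonpos_right hl hle)) _

theorem isLaxPart_deltaPartPos (hτ : ∀ m, τ m ≠ 0) (hi : i ≠ 0) (hv : deg i v = 1)
    (hv0 : deg 0 v = 0) (hother : ∀ j ≠ i, deg j v ≤ 0) (k : ℕ) :
    IsLaxPart τ i k (dress (waveOp τ i v) ^ k).deltaPartPos := by
  refine isLaxPart_of_forall (fun m => ?_) fun j hj m => actOn_deltaPartPos_mem _ fun l hl => ?_
  · have key := actOn_symbol_deltaPartPos_sub_mem hv (waveOp_coeff_of_neg τ (i := i))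
      (dress (waveOp τ i v) ^ k) m
    rw [symbol_dress_pow_mul (isUnit_waveOp hτ i v), symbol_waveOp] at key
    rwa [if_neg hi, add_zero]
  · split_ifs with hj0
    · subst hj0
      exact bareWave_zero_sub_mem_orderGE hτ (by rw [map_add, map_zsmul, hv0, smul_zero, add_zero])
    · rw [add_zero]
      refine Submodule.sub_mem _ (orderGE_anti ?_ (bareWave_mem_orderGE τ _ j))
        (bareWave_mem_orderGE τ m j)
      rw [map_add, map_zsmul, smul_eq_mul]
      exact le_add_of_nonneg_right (mul_nonneg_of_nonpos_of_nonpos hl (hother j hj))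

theorem isLaxPart_B1 (hτ : ∀ m, τ m ≠ 0) (k : ℕ) : IsLaxPart τ 0 k (B1 τ k) := by
  rw [B1, L1, S1_eq_waveOp]
  exact isLaxPart_partLE hτ rfl le_rfl (by decide) k

theorem isLaxPart_B2 (hτ : ∀ m, τ m ≠ 0) (k : ℕ) : IsLaxPart τ 1 k (B2 τ k) := by
  rw [B2, L2, S2_eq_waveOp]
  exact isLaxPart_deltaPartPos hτ one_ne_zero rfl rfl (by decide) k

theorem isLaxPart_B3 (hτ : ∀ m, τ m ≠ 0) (k : ℕ) : IsLaxPart τ 2 k (B3 τ k) := by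
  rw [B3, L3, S3_eq_waveOp]
  exact isLaxPart_partLE hτ rfl le_rfl (by decide) k

theorem isLaxPart_B3' (hτ : ∀ m, τ m ≠ 0) (k : ℕ) : IsLaxPart τ 2 k (B3' τ k) := by
  rw [B3', L3', S3'_eq_waveOp]
  exact isLaxPart_deltaPartPos hτ (by decide) rfl rfl (by decide) k

theorem actOn_bareWave_sum_eq {n₁ n₂ n₃ : ℕ} (hτ : ∀ m, τ m ≠ 0)
    (hKdV : IsKdVTau n₁ n₂ n₃ τ) {D : Fin 3 → DiffOp}
    (hD : ∀ i, IsLaxPart τ i (![n₁, n₂, n₃] i) (D i)) (m : Lat) :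
    actOn (bareWave τ) m (∑ i, D i) =
      fun i => HahnSeries.single (-(![n₁, n₂, n₃] i : ℤ)) 1 * bareWave τ m i := by
  have mem_remainder : actOn (bareWave τ) m (∑ i, D i) -
      (fun i => HahnSeries.single (-(![n₁, n₂, n₃] i : ℤ)) 1 * bareWave τ m i) ∈ remainder m := by
    rw [map_sum, ← Finset.univ_sum_single fun i => _ * bareWave τ m i, ← Finset.sum_sub_distrib]
    exact Submodule.sum_mem _ fun i _ => hD i m
  exact sub_eq_zero.mp <| eq_zero_of_resPairing_eq_zero
    (fun m' i => scaledMiwa_ne_zero (sign_ne_zero i m') (hτ _))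
    (fun m' i => order_scaledMiwa (sign_ne_zero i m') (hτ _)) mem_remainder
    (hKdV.resPairing_actOn_sub_eq_zero _ m)

end LaxPart

/-! ### Wave functions -/

section Wave

/-- The wave functions `Ψ₁`, `Ψ₂`, `Ψ₃`, in uniform notation. -/
def wave (τ : Lat → Ser Var) (i : Fin 3) (m : Lat) (n : ℤ) : TField :=
  sign i m * waveSer i (locExp i * deg i m) (τ (m + shift i)) (τ m) n

theorem Psi1_eq_wave (τ : Lat → Ser Var) : Psi1 τ = wave τ 0 := by
  funext m n
  simp [Psi1, wave, sign, shift, locExp, deg_zero_apply]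

theorem Psi2_eq_wave (τ : Lat → Ser Var) : Psi2 τ = wave τ 1 := by
  funext m n
  simp [Psi2, wave, sign, shift, locExp, deg_one_apply]

theorem Psi3_eq_wave (τ : Lat → Ser Var) : Psi3 τ = wave τ 2 := by
  funext m n
  simp [Psi3, wave, sign, shift, locExp, deg_two_apply]

/-- The numerator of the `i`-th wave function without its exponential factor, as a series in `z`. -/
def bareNumerator (τ : Lat → Ser Var) (i : Fin 3) (m : Lat) : ℤ → Ser Var :=
  zPow (locExp i * deg i m) (miwa (-1) i (τ (m + shift i)))

theorem coeff_bareWave (τ : Lat → Ser Var) (i : Fin 3) (m : Lat) (n : ℤ) :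
    (bareWave τ m i).coeff (locExp i * n) =
      sign i m / algebraMap (Ser Var) TField (τ m) *
        algebraMap (Ser Var) TField (bareNumerator τ i m n) := by
  rw [bareWave, coeff_scaledMiwa, bareNumerator, zPow, miwa_eq_coeff, mul_sub, ← mul_assoc,
    locExp_mul_self, one_mul]

theorem wave_eq (τ : Lat → Ser Var) (i : Fin 3) (m : Lat) (n : ℤ) :
    wave τ i m n = sign i m / algebraMap (Ser Var) TField (τ m) *
      algebraMap (Ser Var) TField (zMul (expXi i) (bareNumerator τ i m) n) := by
  simp only [wave, waveSer, bareNumerator, zMul_zPow, zPow, mul_div_assoc', div_mul_eq_mul_div]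

theorem act_wave_eq {τ : Lat → Ser Var} {i : Fin 3} {k : ℤ} {D : DiffOp} {m : Lat}
    (h : actOn (bareWave τ) m D i = HahnSeries.single (-k) 1 * bareWave τ m i) :
    D.act (wave τ i) m = zPow (-(locExp i * k)) (wave τ i m) := by
  funext n
  have relation (x : ℤ) := congrArg (HahnSeries.coeff · (locExp i * x)) h
  simp only [HahnSeries.coeff_single_mul, one_mul, actOn_eq_sum, Finset.sum_apply, Pi.smul_apply,
    HahnSeries.coeff_sum, HahnSeries.coeff_smul, smul_eq_mul] at relation
  have shifted (x : ℤ) : locExp i * x - -k = locExp i * (x - -(locExp i * k)) := by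
    rw [mul_sub, mul_neg, ← mul_assoc, locExp_mul_self, one_mul]
  simp only [shifted, coeff_bareWave, ← mul_assoc] at relation
  have key := sum_mul_algebraMap_map_eq
    (isLocallyFinite_zExp (fun s : Var => if s.1 = i then 1 else 0)
      (fun s => -locExp i * (s.2 : ℕ))).zMulLinear _ _ _ _
      (zPow (-(locExp i * k)) (bareNumerator τ i m)) relation n
  simp only [act_apply, actOn_eq_sum, smul_eq_mul, wave_eq, ← mul_assoc]
  refine key.trans ?_
  change _ * algebraMap (Ser Var) TField (zMul (expXi i) _ n) = _
  rw [zMul_zPow, zPow, zPow, wave_eq]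

theorem act_Psi_eq_of_isLaxPart {n₁ n₂ n₃ : ℕ} {τ : Lat → Ser Var} (hτ : ∀ m, τ m ≠ 0)
    (hKdV : IsKdVTau n₁ n₂ n₃ τ) {D₁ D₂ D₃ : DiffOp} (h₁ : IsLaxPart τ 0 n₁ D₁)
    (h₂ : IsLaxPart τ 1 n₂ D₂) (h₃ : IsLaxPart τ 2 n₃ D₃) :
    (D₁ + D₂ + D₃).act (Psi1 τ) = (fun m => zPow n₁ (Psi1 τ m)) ∧
      (D₁ + D₂ + D₃).act (Psi2 τ) = (fun m => zPow (-n₂) (Psi2 τ m)) ∧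
      (D₁ + D₂ + D₃).act (Psi3 τ) = fun m => zPow (-n₃) (Psi3 τ m) := by
  have hD : ∀ i, IsLaxPart τ i (![n₁, n₂, n₃] i) (![D₁, D₂, D₃] i) :=
    Fin.forall_fin_succ.mpr ⟨h₁, Fin.forall_fin_two.mpr ⟨h₂, h₃⟩⟩
  have hsum : D₁ + D₂ + D₃ = ∑ i, ![D₁, D₂, D₃] i := (Fin.sum_univ_three ![D₁, D₂, D₃]).symm
  have hact (i : Fin 3) : (D₁ + D₂ + D₃).act (wave τ i) =
      fun m => zPow (-(locExp i * ![n₁, n₂, n₃] i)) (wave τ i m) := by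
    rw [hsum]
    exact funext fun m => act_wave_eq (congrFun (actOn_bareWave_sum_eq hτ hKdV hD m) i)
  rw [Psi1_eq_wave, Psi2_eq_wave, Psi3_eq_wave]
  refine ⟨?_, ?_, ?_⟩
  · simpa [locExp] using hact 0
  · simpa [locExp] using hact 1
  · simpa [locExp] using hact 2

end Wave

end ThreeKP

end

theorem mainTheorem2 (n₁ n₂ n₃ : ℕ) (τ : ThreeKP.Lat → ThreeKP.Ser ThreeKP.Var)
    (hτ : ∀ m, τ m ≠ 0) (hKdV : ThreeKP.IsKdVTau n₁ n₂ n₃ τ) :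
    ((ThreeKP.laxOp n₁ n₂ n₃ τ).act (ThreeKP.Psi1 τ) =
        fun m => ThreeKP.zPow (n₁ : ℤ) (ThreeKP.Psi1 τ m)) ∧
    ((ThreeKP.laxOp n₁ n₂ n₃ τ).act (ThreeKP.Psi2 τ) =
        fun m => ThreeKP.zPow (-(n₂ : ℤ)) (ThreeKP.Psi2 τ m)) ∧
    ((ThreeKP.laxOp n₁ n₂ n₃ τ).act (ThreeKP.Psi3 τ) =
        fun m => ThreeKP.zPow (-(n₃ : ℤ)) (ThreeKP.Psi3 τ m)) ∧
    ((ThreeKP.laxOp' n₁ n₂ n₃ τ).act (ThreeKP.Psi1 τ) =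
        fun m => ThreeKP.zPow (n₁ : ℤ) (ThreeKP.Psi1 τ m)) ∧
    ((ThreeKP.laxOp' n₁ n₂ n₃ τ).act (ThreeKP.Psi2 τ) =
        fun m => ThreeKP.zPow (-(n₂ : ℤ)) (ThreeKP.Psi2 τ m)) ∧
    ((ThreeKP.laxOp' n₁ n₂ n₃ τ).act (ThreeKP.Psi3 τ) =
        fun m => ThreeKP.zPow (-(n₃ : ℤ)) (ThreeKP.Psi3 τ m)) := by
  have h₁ := ThreeKP.isLaxPart_B1 hτ n₁
  have h₂ := ThreeKP.isLaxPart_B2 hτ n₂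
  obtain ⟨hΨ₁, hΨ₂, hΨ₃⟩ :=
    ThreeKP.act_Psi_eq_of_isLaxPart hτ hKdV h₁ h₂ (ThreeKP.isLaxPart_B3 hτ n₃)
  obtain ⟨hΨ₁', hΨ₂', hΨ₃'⟩ :=
    ThreeKP.act_Psi_eq_of_isLaxPart hτ hKdV h₁ h₂ (ThreeKP.isLaxPart_B3' hτ n₃)
  exact ⟨hΨ₁, hΨ₂, hΨ₃, hΨ₁', hΨ₂', hΨ₃'⟩
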